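/- Let $k$ be an algebraically closed field of characteristic zero and let $A$ be a Hopf algebra over $k$ with comultiplication $\Delta$, counit $\varepsilon$ and antipode $S$. Assume that $A$ is cosemisimple (every subcomodule of a right $A$-comodule has a complementary subcomodule) and of Kac type ($S^2=\mathrm{id}_A$). Let $V$ be a (right-right) Yetter-Drinfeld module over $A$, i.e. a right $A$-module and right $A$-comodule with $$(v\leftarrow a)_{(0)}\otimes (v\leftarrow a)_{(1)} = v_{(0)}\leftarrow a_{(2)}\otimes S(a_{(1)})v_{(1)}a_{(3)}\qquad (v\in V,\ a\in A),$$ and let $H^n_{\rm GS}(A,V)=\mathrm{Ext}^n_{\mathcal{YD}^A_A}(k,V)$ be its Gerstenhaber-Schack cohomology, the $\mathrm{Ext}$ being taken in the abelian category of Yetter-Drinfeld modules and $k$ being the trivial Yetter-Drinfeld module. Let ${}_\varepsilon V$ be the $A$-bimodule $V$ with its right action and with left action $a\cdot v=\varepsilon(a)v$, and let $H^n(A,{}_\varepsilon V)$ be its Hochschild cohomology, computed by the complex $\mathrm{Hom}(A^{\otimes n},V)$ with $$\partial f(a_1\otimes\cdots\otimes a_{n+1})=\varepsilon(a_1)f(a_2\otimes\cdots\otimes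 a_{n+1})+\sum_{i=1}^n(-1)^if(a_1\otimes\cdots\otimes a_ia_{i+1}\otimes\cdots\otimes a_{n+1})+(-1)^{n+1}f(a_1\otimes\cdots\otimes a_n)\leftarrow a_{n+1}.$$ Let $A^{\boxtimes n}$ be the Yetter-Drinfeld module with underlying space $A^{\otimes n}$ defined by $A^{\boxtimes 0}=k$ and $A^{\boxtimes (n+1)}=A^{\boxtimes n}\boxtimes A$, where for a right comodule $W$ the module $W\boxtimes A$ is $W\otimes A$ with right multiplication and coaction $w\otimes a\mapsto w_{(0)}\otimes a_{(2)}\otimes S(a_{(1)})w_{(1)}a_{(3)}$. Then the standard complex $\cdots\to A^{\boxtimes 2}\to A^{\boxtimes 1}\to k\to 0$, with differentials $$a_1\otimes\cdots\otimes a_{n+1}\mapsto \varepsilon(a_1)a_2\otimes\cdots\otimes a_{n+1}+\sum_{i=1}^n(-1)^ia_1\otimes\cdots\otimes a_ia_{i+1}\otimes\cdots\otimes a_{n+1},$$ is a projective resolution of $k$ in $\mathcal{YD}^A_A$; for every $n\ge 0$, sending a colinear cocycle $f\in\mathrm{Hom}^A(A^{\boxtimes n},V)$ to the $\mathrm{Ext}$-class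 of the cocycle $A^{\boxtimes n}\boxtimes A\to V$, $x\otimes a\mapsto f(x)\leftarrow a$, induces a linear isomorphism $$H^n\bigl(\mathrm{Hom}^A(A^{\boxtimes\bullet},V)\bigr)\simeq H^n_{\rm GS}(A,V);$$ and the natural linear map $$H^n_{\rm GS}(A,V)\simeq H^n\bigl(\mathrm{Hom}^A(A^{\boxtimes\bullet},V)\bigr)\longrightarrow H^n(A,{}_\varepsilon V),$$ induced by the inclusion of the subcomplex $\mathrm{Hom}^A(A^{\boxtimes\bullet},V)$ into the Hochschild complex $\mathrm{Hom}(A^{\otimes\bullet},V)$, is injective. -/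

import Mathlib

open CategoryTheory TensorProduct

universe u

namespace GS

/-- A right coaction of a coalgebra `A` on a vector space `V`. -/
structure RightCoaction (k A V : Type u) [Field k] [AddCommGroup A] [Module k A] [Coalgebra k A]
    [AddCommGroup V] [Module k V] where
  coact : V →ₗ[k] V ⊗[k] A
  coassoc : (TensorProduct.assoc k V A A).toLinearMap ∘ₗ coact.rTensor A ∘ₗ coact =
    (Coalgebra.comul (R := k) (A := A)).lTensor V ∘ₗ coact
  counit : (Coalgebra.counit (R := k) (A := A)).lTensor V ∘ₗ coact =
    (TensorProduct.mk k V k).flip 1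

/-- A right action of an algebra `A` on a vector space `V`; `act v a` is `v ← a`. -/
structure RightAction (k A V : Type u) [Field k] [Ring A] [Algebra k A]
    [AddCommGroup V] [Module k V] where
  act : V →ₗ[k] A →ₗ[k] V
  act_one : ∀ v, act v 1 = v
  act_mul : ∀ v a b, act v (a * b) = act (act v a) b

section Cosemisimple

variable {k A V : Type u} [Field k] [AddCommGroup A] [Module k A] [Coalgebra k A]
  [AddCommGroup V] [Module k V]

/-- `W` is a subcomodule: the coaction maps `W` into `W ⊗ A`. -/
def RightCoaction.IsSubcomodule (ρ : RightCoaction k A V) (W : Submodule k V) : Prop :=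
  ∀ w ∈ W, ρ.coact w ∈ LinearMap.range (W.subtype.rTensor A)

end Cosemisimple

/-- A coalgebra is cosemisimple if its right comodules are completely reducible: every
subcomodule has a complementary subcomodule. -/
def IsCosemisimple (k A : Type u) [Field k] [AddCommGroup A] [Module k A] [Coalgebra k A] : Prop :=
  ∀ (V : Type u) [AddCommGroup V] [Module k V] (ρ : RightCoaction k A V) (W : Submodule k V),
    ρ.IsSubcomodule W → ∃ W' : Submodule k V, ρ.IsSubcomodule W' ∧ IsCompl W W'

section Twist

variable {k A : Type u} [Field k] [Ring A] [HopfAlgebra k A]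

/-- The iterated comultiplication `a ↦ a₍₁₎ ⊗ (a₍₂₎ ⊗ a₍₃₎)`. -/
noncomputable def comul₃ (k A : Type u) [Field k] [Ring A] [HopfAlgebra k A] :
    A →ₗ[k] A ⊗[k] (A ⊗[k] A) :=
  (Coalgebra.comul (R := k) (A := A)).lTensor A ∘ₗ Coalgebra.comul (R := k) (A := A)

/-- The bilinear map with `b, x ⊗ z ↦ S(x) b z`. -/
noncomputable def sandwich (k A : Type u) [Field k] [Ring A] [HopfAlgebra k A] :
    A →ₗ[k] (A ⊗[k] A) →ₗ[k] A :=
  (TensorProduct.lift ((LinearMap.mul k (Module.End k A)).compl₁₂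
    (LinearMap.mul k A ∘ₗ HopfAlgebra.antipode k) (LinearMap.mul k A).flip)).flip

theorem sandwich_tmul (b x z : A) :
    sandwich k A b (x ⊗ₜ z) = HopfAlgebra.antipode k x * b * z := by
  simp [sandwich, mul_assoc]

/-- For a bilinear map `β : V × A → W`, the bilinear map with
`v ⊗ b, x ⊗ (y ⊗ z) ↦ β(v, y) ⊗ S(x) b z`. -/
noncomputable def ydTwist {V W : Type u} [AddCommGroup V] [Module k V] [AddCommGroup W] [Module k W]
    (β : V →ₗ[k] A →ₗ[k] W) :
    (V ⊗[k] A) →ₗ[k] (A ⊗[k] (A ⊗[k] A)) →ₗ[k] (W ⊗[k] A) :=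
  (TensorProduct.map₂ β (sandwich k A)).compl₂ (TensorProduct.leftComm k A A A).toLinearMap

theorem ydTwist_tmul {V W : Type u} [AddCommGroup V] [Module k V] [AddCommGroup W] [Module k W]
    (β : V →ₗ[k] A →ₗ[k] W) (v : V) (b x y z : A) :
    ydTwist β (v ⊗ₜ b) (x ⊗ₜ (y ⊗ₜ z)) =
      β v y ⊗ₜ[k] (HopfAlgebra.antipode k x * b * z) := by
  simp [ydTwist, sandwich_tmul]

end Twist

/-- A (right-right) Yetter-Drinfeld module over the Hopf algebra `A`. -/
structure YD (k A : Type u) [Field k] [Ring A] [HopfAlgebra k A] where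
  carrier : Type u
  [addCommGroup : AddCommGroup carrier]
  [module : Module k carrier]
  right : RightAction k A carrier
  co : RightCoaction k A carrier
  /-- `(v ← a)₍₀₎ ⊗ (v ← a)₍₁₎ = v₍₀₎ ← a₍₂₎ ⊗ S(a₍₁₎) v₍₁₎ a₍₃₎` -/
  compat : ∀ v a, co.coact (right.act v a) =
    ydTwist right.act (co.coact v) (comul₃ k A a)

namespace YD

variable {k A : Type u} [Field k] [Ring A] [HopfAlgebra k A]

attribute [instance] YD.addCommGroup YD.module

/-- The action of a Yetter-Drinfeld module. -/
noncomputable abbrev act (V : YD k A) : V.carrier →ₗ[k] A →ₗ[k] V.carrier := V.right.act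

/-- The coaction of a Yetter-Drinfeld module. -/
noncomputable abbrev coact (V : YD k A) : V.carrier →ₗ[k] V.carrier ⊗[k] A := V.co.coact

/-- Morphisms of Yetter-Drinfeld modules: `A`-linear and `A`-colinear maps. -/
@[ext]
structure Hom (V W : YD k A) where
  lin : V.carrier →ₗ[k] W.carrier
  map_act : ∀ v a, lin (V.act v a) = W.act (lin v) a
  map_coact : ∀ v, W.coact (lin v) = lin.rTensor A (V.coact v)

noncomputable instance : Category (YD k A) where
  Hom := Hom
  id V := ⟨LinearMap.id, fun _ _ => rfl, fun v => by simp⟩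
  comp f g := ⟨g.lin ∘ₗ f.lin, fun v a => by simp [f.map_act, g.map_act], fun v => by
    simp [f.map_coact, g.map_coact, LinearMap.rTensor_comp]⟩

variable {V W X : YD k A}

@[ext]
theorem hom_ext {f g : V ⟶ W} (h : f.lin = g.lin) : f = g := Hom.ext h

@[simp] theorem id_lin : (𝟙 V : V ⟶ V).lin = LinearMap.id := rfl
@[simp] theorem comp_lin (f : V ⟶ W) (g : W ⟶ X) : (f ≫ g).lin = g.lin ∘ₗ f.lin := rfl

/-- Morphisms form a subspace of the space of linear maps. -/
def homSubmodule (V W : YD k A) : Submodule k (V.carrier →ₗ[k] W.carrier) where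
  carrier := {f | (∀ v a, f (V.act v a) = W.act (f v) a) ∧
    ∀ v, W.coact (f v) = f.rTensor A (V.coact v)}
  zero_mem' := ⟨by simp, by simp⟩
  add_mem' := fun hf hg => ⟨fun v a => by simp [hf.1, hg.1],
    fun v => by simp [hf.2, hg.2, LinearMap.rTensor_add]⟩
  smul_mem' := fun c f hf => ⟨fun v a => by simp [hf.1],
    fun v => by simp [hf.2, LinearMap.rTensor_smul]⟩

/-- Morphisms as elements of `homSubmodule`. -/
def homEquiv (V W : YD k A) : (V ⟶ W) ≃ homSubmodule V W where
  toFun f := ⟨f.lin, f.map_act, f.map_coact⟩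
  invFun f := ⟨f.1, f.2.1, f.2.2⟩
  left_inv _ := rfl
  right_inv _ := rfl

noncomputable instance : AddCommGroup (V ⟶ W) := (homEquiv V W).addCommGroup
noncomputable instance : Module k (V ⟶ W) := (homEquiv V W).module k

@[simp] theorem zero_lin : (0 : V ⟶ W).lin = 0 := rfl
@[simp] theorem add_lin (f g : V ⟶ W) : (f + g).lin = f.lin + g.lin := rfl
@[simp] theorem neg_lin (f : V ⟶ W) : (-f).lin = -f.lin := rfl
@[simp] theorem smul_lin (c : k) (f : V ⟶ W) : (c • f).lin = c • f.lin := rfl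

noncomputable instance : Preadditive (YD k A) where
  add_comp _ _ _ f g h := by ext; simp
  comp_add _ _ _ f g h := by ext; simp

noncomputable instance : Linear k (YD k A) where
  smul_comp _ _ _ c f g := by ext; simp
  comp_smul _ _ _ f c g := by ext; simp

/-- The forgetful functor to vector spaces. -/
noncomputable def forget (k A : Type u) [Field k] [Ring A] [HopfAlgebra k A] :
    YD k A ⥤ ModuleCat.{u} k where
  obj V := ModuleCat.of k V.carrier
  map f := ModuleCat.ofHom f.lin

noncomputable instance : (forget k A).Additive where
noncomputable instance : (forget k A).Faithful where
  map_injective h := hom_ext (congrArg ModuleCat.Hom.hom h :)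

theorem isIso_of_bijective (f : V ⟶ W) (hf : Function.Bijective f.lin) : IsIso f := by
  let e := LinearEquiv.ofBijective f.lin hf
  have he : ∀ v, e v = f.lin v := fun _ => rfl
  have h1 : e.symm.toLinearMap ∘ₗ f.lin = LinearMap.id := by ext v; simp [← he]
  have h2 : f.lin ∘ₗ e.symm.toLinearMap = LinearMap.id := by ext v; simp [← he]
  refine ⟨⟨e.symm.toLinearMap, fun v a => ?_, fun v => ?_⟩, ?_, ?_⟩
  · apply hf.1
    rw [f.map_act]
    simp [← he]
  · have h3 : f.lin.rTensor A (V.coact (e.symm v)) = W.coact v := by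
      rw [← f.map_coact, ← he]; simp
    change V.coact (e.symm v) = e.symm.toLinearMap.rTensor A (W.coact v)
    rw [← h3, ← LinearMap.comp_apply (LinearMap.rTensor A _), ← LinearMap.rTensor_comp, h1]
    simp
  · ext v; exact LinearMap.congr_fun h1 v
  · ext v; exact LinearMap.congr_fun h2 v

instance : (forget k A).ReflectsIsomorphisms where
  reflects f _ := isIso_of_bijective f
    ((ConcreteCategory.isIso_iff_bijective ((forget k A).map f)).1 inferInstance)

section Naturality

variable {M N : Type u} [AddCommGroup M] [Module k M] [AddCommGroup N] [Module k N]
  {f : M →ₗ[k] N} {r : M →ₗ[k] M ⊗[k] A} {s : N →ₗ[k] N ⊗[k] A}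

theorem coassoc_left_nat (h : s ∘ₗ f = f.rTensor A ∘ₗ r) :
    ((TensorProduct.assoc k N A A).toLinearMap ∘ₗ s.rTensor A ∘ₗ s) ∘ₗ f =
      f.rTensor (A ⊗[k] A) ∘ₗ ((TensorProduct.assoc k M A A).toLinearMap ∘ₗ r.rTensor A ∘ₗ r) := by
  have h' : (TensorProduct.assoc k N A A).toLinearMap ∘ₗ (f.rTensor A).rTensor A =
      f.rTensor (A ⊗[k] A) ∘ₗ (TensorProduct.assoc k M A A).toLinearMap := by
    apply TensorProduct.ext_threefold; intros; rfl
  have h'' : s.rTensor A ∘ₗ f.rTensor A = (f.rTensor A).rTensor A ∘ₗ r.rTensor A := by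
    rw [← LinearMap.rTensor_comp, h, LinearMap.rTensor_comp]
  simp only [LinearMap.comp_assoc]
  rw [h, ← LinearMap.comp_assoc r, h'']
  simp only [← LinearMap.comp_assoc]
  rw [h']

theorem lTensor_nat {P : Type u} [AddCommGroup P] [Module k P] (c : A →ₗ[k] P)
    (h : s ∘ₗ f = f.rTensor A ∘ₗ r) :
    (c.lTensor N ∘ₗ s) ∘ₗ f = f.rTensor P ∘ₗ (c.lTensor M ∘ₗ r) := by
  rw [LinearMap.comp_assoc, h, ← LinearMap.comp_assoc, ← LinearMap.comp_assoc,
    LinearMap.lTensor_comp_rTensor, LinearMap.rTensor_comp_lTensor]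

theorem ydTwist_nat {α : M →ₗ[k] A →ₗ[k] M} {β : N →ₗ[k] A →ₗ[k] N}
    (h : ∀ m a, f (α m a) = β (f m) a) (t : M ⊗[k] A) (c : A ⊗[k] (A ⊗[k] A)) :
    ydTwist β (f.rTensor A t) c = f.rTensor A (ydTwist α t c) := by
  have : (ydTwist β) ∘ₗ f.rTensor A = (ydTwist α).compr₂ (f.rTensor A) := by
    ext m b x y z
    simp [ydTwist_tmul, h]
  exact LinearMap.congr_fun (LinearMap.congr_fun this t) c

end Naturality

/-- The Yetter-Drinfeld structure on a quotient space. -/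
noncomputable abbrev ofSurjective (V : YD k A) {N : Type u} [AddCommGroup N] [Module k N]
    (f : V.carrier →ₗ[k] N) (hf : Function.Surjective f) (β : N →ₗ[k] A →ₗ[k] N)
    (s : N →ₗ[k] N ⊗[k] A) (hβ : ∀ v a, f (V.act v a) = β (f v) a)
    (hs : s ∘ₗ f = f.rTensor A ∘ₗ V.coact) : YD k A where
  carrier := N
  right := 
    { act := β
      act_one := fun n => by
        obtain ⟨v, rfl⟩ := hf n
        rw [← hβ, V.right.act_one]
      act_mul := fun n a b => by
        obtain ⟨v, rfl⟩ := hf n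
        rw [← hβ, ← hβ, ← hβ, V.right.act_mul] }
  co := 
    { coact := s
      coassoc := by
        rw [← LinearMap.cancel_right hf, coassoc_left_nat hs, lTensor_nat _ hs, V.co.coassoc]
      counit := by
        rw [← LinearMap.cancel_right hf, lTensor_nat _ hs, V.co.counit]
        rfl }
  compat := fun n a => by
    obtain ⟨v, rfl⟩ := hf n
    have h : ∀ v, s (f v) = f.rTensor A (V.coact v) := fun v => LinearMap.congr_fun hs v
    rw [← hβ, h, h, ydTwist_nat hβ, V.compat]

/-- The Yetter-Drinfeld structure on a subspace. -/
noncomputable abbrev ofInjective (V : YD k A) {M : Type u} [AddCommGroup M] [Module k M]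
    (f : M →ₗ[k] V.carrier) (hf : Function.Injective f) (α : M →ₗ[k] A →ₗ[k] M)
    (r : M →ₗ[k] M ⊗[k] A) (hα : ∀ v a, f (α v a) = V.act (f v) a)
    (hr : V.coact ∘ₗ f = f.rTensor A ∘ₗ r) : YD k A where
  carrier := M
  right := 
    { act := α
      act_one := fun n => hf (by rw [hα, V.right.act_one])
      act_mul := fun n a b => hf (by rw [hα, hα, hα, V.right.act_mul]) }
  co := 
    { coact := r
      coassoc := by
        rw [← LinearMap.cancel_left (Module.Flat.rTensor_preserves_injective_linearMap f hf),
          ← coassoc_left_nat hr, ← lTensor_nat _ hr, V.co.coassoc]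
      counit := by
        rw [← LinearMap.cancel_left (Module.Flat.rTensor_preserves_injective_linearMap f hf),
          ← lTensor_nat _ hr, V.co.counit]
        rfl }
  compat := fun n a => by
    apply Module.Flat.rTensor_preserves_injective_linearMap (M := A) f hf
    have h : ∀ v, V.coact (f v) = f.rTensor A (r v) := fun v => LinearMap.congr_fun hr v
    rw [← h, hα, V.compat, h, ydTwist_nat hα]

/-- The zero Yetter-Drinfeld module. -/
noncomputable def zeroYD (k A : Type u) [Field k] [Ring A] [HopfAlgebra k A] : YD k A where
  carrier := PUnit
  right := ⟨0, fun _ => rfl, fun _ _ _ => rfl⟩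
  co := ⟨0, by simp, by
    refine LinearMap.ext fun v => ?_
    rw [Subsingleton.elim v 0, map_zero, map_zero]⟩
  compat _ _ := by simp

instance : Limits.HasZeroObject (YD k A) :=
  ⟨zeroYD k A, by
    refine (Limits.IsZero.iff_id_eq_zero _).2 (hom_ext ?_)
    exact LinearMap.ext fun v => rfl⟩

/-- The direct sum of two Yetter-Drinfeld modules. -/
noncomputable abbrev prod (V W : YD k A) : YD k A where
  carrier := V.carrier × W.carrier
  right :=
    { act := (V.act.compr₂ (LinearMap.inl k _ _)) ∘ₗ LinearMap.fst k _ _ +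
        (W.act.compr₂ (LinearMap.inr k _ _)) ∘ₗ LinearMap.snd k _ _
      act_one := fun v => by simp [V.right.act_one, W.right.act_one]
      act_mul := fun v a b => by simp [V.right.act_mul, W.right.act_mul] }
  co :=
    { coact := (LinearMap.inl k _ _).rTensor A ∘ₗ V.coact ∘ₗ LinearMap.fst k _ _ +
        (LinearMap.inr k _ _).rTensor A ∘ₗ W.coact ∘ₗ LinearMap.snd k _ _
      coassoc := by
        apply LinearMap.prod_ext
        · rw [coassoc_left_nat (r := V.coact), lTensor_nat (r := V.coact), V.co.coassoc] <;>
          · ext; simp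
        · rw [coassoc_left_nat (r := W.coact), lTensor_nat (r := W.coact), W.co.coassoc] <;>
          · ext; simp
      counit := by
        apply LinearMap.prod_ext
        · rw [lTensor_nat (r := V.coact), V.co.counit] 
          · rfl
          · ext; simp
        · rw [lTensor_nat (r := W.coact), W.co.counit] 
          · rfl
          · ext; simp }
  compat v a := by
    simp only [LinearMap.add_apply, LinearMap.comp_apply, map_add]
    rw [ydTwist_nat (α := V.act), ydTwist_nat (α := W.act), ← V.compat, ← W.compat] <;> simp

theorem prod_act (V W : YD k A) (v : V.carrier × W.carrier) (a : A) :
    (prod V W).act v a = (V.act v.1 a, W.act v.2 a) := by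
  change (V.act v.1 a, (0 : W.carrier)) + ((0 : V.carrier), W.act v.2 a) = _
  simp

theorem prod_coact (V W : YD k A) (v : V.carrier × W.carrier) :
    (prod V W).coact v = (LinearMap.inl k _ _).rTensor A (V.coact v.1) +
      (LinearMap.inr k _ _).rTensor A (W.coact v.2) := rfl

/-- The binary biproduct. -/
noncomputable abbrev prodBicone (V W : YD k A) : Limits.BinaryBicone V W where
  pt := prod V W
  fst := ⟨LinearMap.fst k V.carrier W.carrier, fun v a => by rw [prod_act]; rfl, fun v => by
    rw [prod_coact, map_add, ← LinearMap.rTensor_comp_apply, ← LinearMap.rTensor_comp_apply]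
    simp⟩
  snd := ⟨LinearMap.snd k V.carrier W.carrier, fun v a => by rw [prod_act]; rfl, fun v => by
    rw [prod_coact, map_add, ← LinearMap.rTensor_comp_apply, ← LinearMap.rTensor_comp_apply]
    simp⟩
  inl := ⟨LinearMap.inl k V.carrier W.carrier,
    fun v a => by rw [prod_act]; simp, fun v => by rw [prod_coact]; simp⟩
  inr := ⟨LinearMap.inr k V.carrier W.carrier,
    fun v a => by rw [prod_act]; simp, fun v => by rw [prod_coact]; simp⟩
  inl_fst := hom_ext (LinearMap.fst_comp_inl k V.carrier W.carrier)
  inl_snd := hom_ext (LinearMap.snd_comp_inl k V.carrier W.carrier)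
  inr_fst := hom_ext (LinearMap.fst_comp_inr k V.carrier W.carrier)
  inr_snd := hom_ext (LinearMap.snd_comp_inr k V.carrier W.carrier)

instance : Limits.HasBinaryBiproducts (YD k A) where
  has_binary_biproduct V W := Limits.hasBinaryBiproduct_of_total (prodBicone V W)
    (hom_ext (LinearMap.ext fun v => by
      change ((v.1, 0) : V.carrier × W.carrier) + (0, v.2) = v
      simp))

theorem rTensor_ker_injective (f : V ⟶ W) :
    Function.Injective (f.lin.ker.subtype.rTensor A) :=
  Module.Flat.rTensor_preserves_injective_linearMap _ f.lin.ker.injective_subtype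

theorem coact_ker_mem (f : V ⟶ W) (v : f.lin.ker) :
    (V.coact ∘ₗ f.lin.ker.subtype) v ∈ LinearMap.range (f.lin.ker.subtype.rTensor A) := by
  refine (Module.Flat.rTensor_exact A (LinearMap.exact_subtype_ker_map f.lin) _).1 ?_
  have h : f.lin v = 0 := v.2
  change f.lin.rTensor A (V.coact v) = 0
  rw [← f.map_coact, h, map_zero]

/-- The coaction on the kernel of a morphism. -/
noncomputable def kerCoact (f : V ⟶ W) : f.lin.ker →ₗ[k] f.lin.ker ⊗[k] A :=
  (LinearEquiv.ofInjective _ (rTensor_ker_injective f)).symm.toLinearMap ∘ₗ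
      (V.coact ∘ₗ f.lin.ker.subtype).codRestrict _ (coact_ker_mem f)

theorem ker_coact (f : V ⟶ W) :
    V.coact ∘ₗ f.lin.ker.subtype = f.lin.ker.subtype.rTensor A ∘ₗ kerCoact f := by
  refine LinearMap.ext fun v => ?_
  have := LinearEquiv.apply_symm_apply (LinearEquiv.ofInjective _ (rTensor_ker_injective f))
    ((V.coact ∘ₗ f.lin.ker.subtype).codRestrict _ (coact_ker_mem f) v)
  exact (congrArg Subtype.val this).symm

/-- The action on the kernel of a morphism. -/
noncomputable def kerAct (f : V ⟶ W) : f.lin.ker →ₗ[k] A →ₗ[k] f.lin.ker :=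
  LinearMap.mk₂ k (fun v a => ⟨V.act v a, by
        rw [LinearMap.mem_ker, f.map_act, LinearMap.mem_ker.1 v.2]; simp⟩)
      (fun _ _ _ => by ext; simp) (fun _ _ _ => by ext; simp)
      (fun _ _ _ => by ext; simp) (fun _ _ _ => by ext; simp)

/-- The kernel of a morphism, on the kernel of the underlying linear map. -/
noncomputable abbrev ker (f : V ⟶ W) : YD k A :=
  ofInjective V f.lin.ker.subtype f.lin.ker.injective_subtype (kerAct f) (kerCoact f)
    (fun _ _ => rfl) (ker_coact f)

/-- The inclusion of the kernel. -/
noncomputable abbrev kerι (f : V ⟶ W) : ker f ⟶ V :=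
  ⟨f.lin.ker.subtype, fun _ _ => rfl, fun v => LinearMap.congr_fun (ker_coact f) v⟩

/-- The cokernel of a morphism, on the cokernel of the underlying linear map. -/
noncomputable abbrev coker (f : V ⟶ W) : YD k A :=
  ofSurjective W f.lin.range.mkQ f.lin.range.mkQ_surjective
    (f.lin.range.liftQ (W.act.compr₂ f.lin.range.mkQ) (by
      rintro _ ⟨v, rfl⟩
      ext a
      simp [← f.map_act]))
    (f.lin.range.liftQ (f.lin.range.mkQ.rTensor A ∘ₗ W.coact) (by
      rintro _ ⟨v, rfl⟩
      have : f.lin.range.mkQ ∘ₗ f.lin = 0 := by ext; simp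
      rw [LinearMap.mem_ker, LinearMap.comp_apply, f.map_coact, ← LinearMap.rTensor_comp_apply,
        this]
      simp))
    (fun _ _ => rfl) rfl

/-- The projection to the cokernel. -/
noncomputable abbrev cokerπ (f : V ⟶ W) : W ⟶ coker f :=
  ⟨f.lin.range.mkQ, fun _ _ => rfl, fun _ => rfl⟩

theorem kerι_comp (f : V ⟶ W) : kerι f ≫ f = 0 := hom_ext (LinearMap.comp_ker_subtype f.lin)

theorem comp_cokerπ (f : V ⟶ W) : f ≫ cokerπ f = 0 := hom_ext (LinearMap.range_mkQ_comp f.lin)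

/-- The kernel has the universal property. -/
noncomputable def kerIsLimit (f : V ⟶ W) :
    Limits.IsLimit (Limits.KernelFork.ofι (kerι f) (kerι_comp f)) :=
  Limits.KernelFork.IsLimit.ofι _ _
    (fun {X} g hg => ⟨LinearMap.codRestrict _ g.lin
        (fun v => LinearMap.mem_ker.2 (LinearMap.congr_fun (congrArg Hom.lin hg) v)),
      fun v a => Subtype.ext (g.map_act v a), fun v => by
        apply Module.Flat.rTensor_preserves_injective_linearMap (M := A) _
          f.lin.ker.injective_subtype
        refine ((kerι f).map_coact _).symm.trans ?_
        rw [← LinearMap.rTensor_comp_apply]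
        exact g.map_coact v⟩)
    (fun _ _ => rfl)
    (fun _ _ m hm => hom_ext (LinearMap.ext fun v =>
      Subtype.ext (LinearMap.congr_fun (congrArg Hom.lin hm) v)))

/-- The cokernel has the universal property. -/
noncomputable def cokerIsColimit (f : V ⟶ W) :
    Limits.IsColimit (Limits.CokernelCofork.ofπ (cokerπ f) (comp_cokerπ f)) :=
  Limits.CokernelCofork.IsColimit.ofπ _ _
    (fun {X} g hg => ⟨f.lin.range.liftQ g.lin (by
          rintro _ ⟨v, rfl⟩
          exact LinearMap.mem_ker.2 (LinearMap.congr_fun (congrArg Hom.lin hg) v)),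
      fun v a => by
        obtain ⟨v, rfl⟩ := f.lin.range.mkQ_surjective v
        exact g.map_act v a, 
      fun v => by
        obtain ⟨v, rfl⟩ := f.lin.range.mkQ_surjective v
        refine (g.map_coact v).trans ?_
        refine Eq.trans ?_ (congrArg _ ((cokerπ f).map_coact v).symm)
        rw [← LinearMap.rTensor_comp_apply]
        rfl⟩)
    (fun _ _ => rfl)
    (fun _ _ m hm => hom_ext (LinearMap.ext fun v => by
      obtain ⟨v, rfl⟩ := f.lin.range.mkQ_surjective v
      exact LinearMap.congr_fun (congrArg Hom.lin hm) v))

instance : Limits.HasKernels (YD k A) where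
  has_limit f := ⟨⟨⟨_, kerIsLimit f⟩⟩⟩

instance : Limits.HasCokernels (YD k A) where
  has_colimit f := ⟨⟨⟨_, cokerIsColimit f⟩⟩⟩

instance (f : V ⟶ W) : Limits.PreservesLimit (Limits.parallelPair f 0) (forget k A) :=
  Limits.preservesLimit_of_preserves_limit_cone (kerIsLimit f)
    ((Limits.KernelFork.isLimitMapConeEquiv _ _).symm
      (ModuleCat.kernelIsLimit ((forget k A).map f)))

instance (f : V ⟶ W) : Limits.PreservesColimit (Limits.parallelPair f 0) (forget k A) :=
  Limits.preservesColimit_of_preserves_colimit_cocone (cokerIsColimit f)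
    ((Limits.CokernelCofork.isColimitMapCoconeEquiv _ _).symm
      (ModuleCat.cokernelIsColimit ((forget k A).map f)))

instance (f : V ⟶ W) : IsIso (Abelian.coimageImageComparison f) :=
  have := IsIso.of_isIso_fac_right
    (Abelian.PreservesCoimage.hom_coimageImageComparison (forget k A) f).symm
  isIso_of_reflects_iso _ (forget k A)

instance : Limits.HasFiniteProducts (YD k A) :=
  hasFiniteProducts_of_has_binary_and_terminal

noncomputable instance : Abelian (YD k A) := Abelian.ofCoimageImageComparisonIsIso

instance : HasExt.{u + 1} (YD k A) := HasExt.standard _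

end YD

section Hopf

open Coalgebra HopfAlgebra

variable {k A : Type u} [Field k] [Ring A] [HopfAlgebra k A]

theorem comul_four : (TensorProduct.map (comul (R := k) (A := A)) comul) ∘ₗ comul (R := k) =
    (TensorProduct.assoc k A A (A ⊗[k] A)).symm.toLinearMap ∘ₗ
      (TensorProduct.assoc k A A A).toLinearMap.lTensor A ∘ₗ
      ((comul (R := k) (A := A)).rTensor A).lTensor A ∘ₗ
      (comul (R := k) (A := A)).lTensor A ∘ₗ comul (R := k) := by
  simp [coassoc_simps]

theorem comul_antipode (a : A) : comul (R := k) (antipode k a) =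
    TensorProduct.map (antipode k) (antipode k) (TensorProduct.comm k A A (comul a)) := by
  have h : WithConv.toConv ((TensorProduct.map (antipode k (A := A)) (antipode k (A := A))) ∘ₗ
      (TensorProduct.comm k A A).toLinearMap ∘ₗ comul) *
      WithConv.toConv (comul (R := k) (A := A)) = 1 := by
    apply WithConv.ofConv_injective
    let P : A ⊗[k] ((A ⊗[k] A) ⊗[k] A) →ₗ[k] A ⊗[k] A := LinearMap.mul' k (A ⊗[k] A) ∘ₗ
        TensorProduct.map (TensorProduct.map (antipode k) (antipode k) ∘ₗ
          (TensorProduct.comm k A A).toLinearMap) LinearMap.id ∘ₗ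
        (TensorProduct.assoc k A A (A ⊗[k] A)).symm.toLinearMap ∘ₗ
        (TensorProduct.assoc k A A A).toLinearMap.lTensor A
    let Q : A ⊗[k] (A ⊗[k] A) →ₗ[k] A ⊗[k] A :=
      (LinearMap.mul' k A ∘ₗ (antipode k (A := A)).rTensor A).lTensor A ∘ₗ
        (TensorProduct.leftComm k A A A).toLinearMap
    have e1 : P = Q ∘ₗ ((LinearMap.mul' k A ∘ₗ (antipode k).rTensor A).rTensor A).lTensor A := by
      ext x y z w
      simp [P, Q]
    have e2 : LinearMap.mul' k (A ⊗[k] A) ∘ₗ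
        TensorProduct.map (TensorProduct.map (antipode k (A := A)) (antipode k (A := A)) ∘ₗ
          (TensorProduct.comm k A A).toLinearMap ∘ₗ comul) (comul (R := k) (A := A)) ∘ₗ
        comul (R := k) = P ∘ₗ ((comul (R := k) (A := A)).rTensor A).lTensor A ∘ₗ
          (comul (R := k) (A := A)).lTensor A ∘ₗ comul (R := k) := by
      rw [show TensorProduct.map (TensorProduct.map (antipode k (A := A)) (antipode k (A := A)) ∘ₗ
        (TensorProduct.comm k A A).toLinearMap ∘ₗ comul) (comul (R := k) (A := A)) =
        TensorProduct.map (TensorProduct.map (antipode k (A := A)) (antipode k (A := A)) ∘ₗ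
        (TensorProduct.comm k A A).toLinearMap) LinearMap.id ∘ₗ TensorProduct.map comul comul by
          rw [← TensorProduct.map_comp]; rfl, LinearMap.comp_assoc, comul_four]
      rfl
    have e3 (t : A ⊗[k] A) : Q (((Algebra.linearMap k A).rTensor A ∘ₗ
        TensorProduct.mk k k A 1).lTensor A t) =
        1 ⊗ₜ[k] (LinearMap.mul' k A ((antipode k).rTensor A t)) := by
      induction t with
      | zero => simp
      | add x y hx hy => simp only [map_add, hx, hy, TensorProduct.tmul_add]
      | tmul x y => simp [Q]
    rw [LinearMap.convMul_def, LinearMap.convOne_def]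
    refine e2.trans ?_
    rw [e1]
    refine LinearMap.ext fun a => ?_
    have e4 : ((LinearMap.mul' k A ∘ₗ (antipode k).rTensor A).rTensor A).lTensor A ∘ₗ
        ((comul (R := k) (A := A)).rTensor A).lTensor A ∘ₗ (comul (R := k) (A := A)).lTensor A =
        ((Algebra.linearMap k A).rTensor A ∘ₗ TensorProduct.mk k k A 1).lTensor A := by
      simp only [← LinearMap.lTensor_comp]
      rw [← LinearMap.comp_assoc, ← LinearMap.rTensor_comp, LinearMap.comp_assoc, mul_antipode_rTensor_comul,
        LinearMap.rTensor_comp, LinearMap.comp_assoc, rTensor_counit_comp_comul]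
    change Q ((((LinearMap.mul' k A ∘ₗ (antipode k).rTensor A).rTensor A).lTensor A ∘ₗ
        ((comul (R := k) (A := A)).rTensor A).lTensor A ∘ₗ
        (comul (R := k) (A := A)).lTensor A) (comul a)) = _
    rw [e4, e3, mul_antipode_rTensor_comul_apply]
    simp [Algebra.algebraMap_eq_smul_one, Algebra.TensorProduct.one_def]
  have := left_inv_eq_right_inv h (LinearMap.comul_right_inv (R := k) (C := A))
  exact (LinearMap.congr_fun (WithConv.toConv_injective this) a).symm

/-- `x ⊗ (y ⊗ z) ↦ x ⊗ (y₍₁₎ ⊗ (y₍₂₎ ⊗ (y₍₃₎ ⊗ z)))` -/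
noncomputable def expandMid (k A : Type u) [Field k] [Ring A] [HopfAlgebra k A] :
    A ⊗[k] (A ⊗[k] A) →ₗ[k] A ⊗[k] (A ⊗[k] (A ⊗[k] (A ⊗[k] A))) :=
  ((TensorProduct.assoc k A A A).toLinearMap.lTensor A ∘ₗ
    (TensorProduct.assoc k A (A ⊗[k] A) A).toLinearMap ∘ₗ (comul₃ k A).rTensor A).lTensor A

/-- `x ⊗ (y ⊗ z) ↦ x₍₁₎ ⊗ (x₍₂₎ ⊗ (y ⊗ (z₍₁₎ ⊗ z₍₂₎)))` -/
noncomputable def expandEnds (k A : Type u) [Field k] [Ring A] [HopfAlgebra k A] :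
    A ⊗[k] (A ⊗[k] A) →ₗ[k] A ⊗[k] (A ⊗[k] (A ⊗[k] (A ⊗[k] A))) :=
  (TensorProduct.assoc k A A _).toLinearMap ∘ₗ
    TensorProduct.map comul ((comul (R := k) (A := A)).lTensor A)

theorem expand_comul₃ : expandMid k A ∘ₗ comul₃ k A = expandEnds k A ∘ₗ comul₃ k A := by
  simp [expandMid, expandEnds, comul₃, coassoc_simps]


theorem comul₃_mul (a b : A) : comul₃ k A (a * b) = comul₃ k A a * comul₃ k A b := by
  have (s t : A ⊗[k] A) : (comul (R := k) (A := A)).lTensor A (s * t) =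
      (comul (R := k) (A := A)).lTensor A s * (comul (R := k) (A := A)).lTensor A t :=
    map_mul (Algebra.TensorProduct.map (AlgHom.id k A) (Bialgebra.comulAlgHom k A)) s t
  simp only [comul₃, LinearMap.comp_apply, Bialgebra.comul_mul, this]

section Box

variable {W : Type u} [AddCommGroup W] [Module k W]

/-- The right multiplication action on `W ⊗ A`. -/
noncomputable def boxAct (k A W : Type u) [Field k] [Ring A] [HopfAlgebra k A] [AddCommGroup W]
    [Module k W] : (W ⊗[k] A) →ₗ[k] A →ₗ[k] (W ⊗[k] A) :=
  (LinearMap.lTensorHom W ∘ₗ (LinearMap.mul k A).flip).flip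

@[simp] theorem boxAct_tmul (w : W) (a b : A) :
    boxAct k A W (w ⊗ₜ a) b = w ⊗ₜ (a * b) := by simp [boxAct]

/-- The coaction `w ⊗ a ↦ w₍₀₎ ⊗ a₍₂₎ ⊗ S(a₍₁₎) w₍₁₎ a₍₃₎` on `W ⊗ A`. -/
noncomputable def boxCoact (r : W →ₗ[k] W ⊗[k] A) : (W ⊗[k] A) →ₗ[k] (W ⊗[k] A) ⊗[k] A :=
  TensorProduct.lift ((ydTwist (TensorProduct.mk k W A)).compl₁₂ r (comul₃ k A))

@[simp] theorem boxCoact_tmul (r : W →ₗ[k] W ⊗[k] A) (w : W) (a : A) :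
    boxCoact r (w ⊗ₜ a) = ydTwist (TensorProduct.mk k W A) (r w) (comul₃ k A a) := by
  simp [boxCoact]

theorem box_act_mul (v : W ⊗[k] A) (a b : A) :
    boxAct k A W v (a * b) = boxAct k A W (boxAct k A W v a) b := by
  induction v with
  | zero => simp
  | add x y hx hy => simp [hx, hy]
  | tmul w c => simp [mul_assoc]

theorem box_compat (r : W →ₗ[k] W ⊗[k] A) (v : W ⊗[k] A) (b : A) :
    boxCoact r (boxAct k A W v b) = ydTwist (boxAct k A W) (boxCoact r v) (comul₃ k A b) := by
  have key (t : W ⊗[k] A) (p q : A ⊗[k] (A ⊗[k] A)) :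
      ydTwist (TensorProduct.mk k W A) t (p * q) =
        ydTwist (boxAct k A W) (ydTwist (TensorProduct.mk k W A) t p) q := by
    induction t with
    | zero => simp
    | add x y hx hy => simp only [map_add, LinearMap.add_apply, hx, hy]
    | tmul w c =>
      induction p with
      | zero => simp
      | add x y hx hy => simp only [map_add, LinearMap.add_apply, add_mul, hx, hy]
      | tmul x p =>
        induction p with
        | zero => simp
        | add x y hx hy => simp only [map_add, LinearMap.add_apply, TensorProduct.tmul_add, add_mul, hx, hy]
        | tmul y z =>
          induction q with
          | zero => simp
          | add x y hx hy => simp only [map_add, mul_add, hx, hy]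
          | tmul x' q =>
            induction q with
            | zero => simp
            | add x y hx hy => simp only [map_add, TensorProduct.tmul_add, mul_add, hx, hy]
            | tmul y' z' =>
              simp [ydTwist_tmul, antipode_mul_antidistrib, mul_assoc]
  induction v with
  | zero => simp
  | add x y hx hy => simp only [map_add, LinearMap.add_apply, hx, hy]
  | tmul w a => rw [boxAct_tmul, boxCoact_tmul, boxCoact_tmul, comul₃_mul, key]

theorem box_counit (ρ : RightCoaction k A W) :
    (counit (R := k) (A := A)).lTensor (W ⊗[k] A) ∘ₗ boxCoact ρ.coact =
      (TensorProduct.mk k (W ⊗[k] A) k).flip 1 := by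
  let C : A ⊗[k] (A ⊗[k] A) →ₗ[k] A :=
    (TensorProduct.lid k A).toLinearMap ∘ₗ TensorProduct.map counit
      ((TensorProduct.rid k A).toLinearMap ∘ₗ (counit (R := k) (A := A)).lTensor A)
  have hC (a : A) : C (comul₃ k A a) = a := by
    have h : C ∘ₗ comul₃ k A = LinearMap.id := by
      have h1 : C = (TensorProduct.lid k A).toLinearMap ∘ₗ (counit (R := k) (A := A)).rTensor A ∘ₗ
          ((TensorProduct.rid k A).toLinearMap ∘ₗ (counit (R := k) (A := A)).lTensor A).lTensor A := by
        ext; simp [C]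
      have h2 : (TensorProduct.rid k A).toLinearMap ∘ₗ (counit (R := k) (A := A)).lTensor A ∘ₗ
          comul (R := k) = LinearMap.id := by
        rw [lTensor_counit_comp_comul]; ext; simp
      rw [h1, comul₃]
      simp only [LinearMap.comp_assoc]
      rw [← LinearMap.comp_assoc _ _ (LinearMap.lTensor A (_ ∘ₗ _)), ← LinearMap.lTensor_comp,
        LinearMap.comp_assoc, h2, LinearMap.lTensor_id, LinearMap.id_comp,
        rTensor_counit_comp_comul]
      ext; simp
    exact LinearMap.congr_fun h a
  have key (t : W ⊗[k] A) (p : A ⊗[k] (A ⊗[k] A)) :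
      (counit (R := k) (A := A)).lTensor (W ⊗[k] A) (ydTwist (TensorProduct.mk k W A) t p) =
        (TensorProduct.rightComm k W k A) ((counit (R := k) (A := A)).lTensor W t ⊗ₜ C p) := by
    induction t with
    | zero => simp
    | add x y hx hy => simp only [map_add, LinearMap.add_apply, TensorProduct.add_tmul, hx, hy]
    | tmul w c =>
      induction p with
      | zero => simp
      | add x y hx hy => simp only [map_add, TensorProduct.tmul_add, hx, hy]
      | tmul x p =>
        induction p with
        | zero => simp
        | add x y hx hy => simp only [map_add, TensorProduct.tmul_add, hx, hy]
        | tmul y z =>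
          simp [ydTwist_tmul, C, TensorProduct.smul_tmul', TensorProduct.tmul_smul]
          rw [← TensorProduct.smul_tmul', TensorProduct.smul_tmul, smul_eq_mul]
          congr 1
          ring
  ext w a
  have h := LinearMap.congr_fun ρ.counit w
  simp only [LinearMap.comp_apply] at h
  simp [key, h, hC]

theorem box_coassoc (ρ : RightCoaction k A W) :
    (TensorProduct.assoc k (W ⊗[k] A) A A).toLinearMap ∘ₗ (boxCoact ρ.coact).rTensor A ∘ₗ
      boxCoact ρ.coact =
    (comul (R := k) (A := A)).lTensor (W ⊗[k] A) ∘ₗ boxCoact ρ.coact := by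
  let σ : A ⊗[k] (A ⊗[k] (A ⊗[k] (A ⊗[k] A))) →ₗ[k] (A ⊗[k] (A ⊗[k] A)) ⊗[k] (A ⊗[k] A) :=
    (TensorProduct.leftComm k A (A ⊗[k] (A ⊗[k] A)) A).toLinearMap ∘ₗ
      ((TensorProduct.assoc k A (A ⊗[k] A) A).symm.toLinearMap ∘ₗ
        (TensorProduct.assoc k A A A).symm.toLinearMap.lTensor A).lTensor A
  let Q := TensorProduct.map₂ (ydTwist (TensorProduct.mk k W A)) (sandwich k A)
  have key1 (t : W ⊗[k] A) (p : A ⊗[k] (A ⊗[k] A)) :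
      (boxCoact ρ.coact).rTensor A (ydTwist (TensorProduct.mk k W A) t p) =
        Q (ρ.coact.rTensor A t) (σ (expandMid k A p)) := by
    induction t with
    | zero => simp
    | add x y hx hy => simp only [map_add, LinearMap.add_apply, hx, hy]
    | tmul w c =>
      induction p with
      | zero => simp
      | add x y hx hy => simp only [map_add, hx, hy]
      | tmul x p =>
        induction p with
        | zero => simp
        | add x y hx hy => simp only [map_add, TensorProduct.tmul_add, hx, hy]
        | tmul y z =>
          have h (q : A ⊗[k] (A ⊗[k] A)) : σ (x ⊗ₜ ((TensorProduct.assoc k A A A).toLinearMap.lTensor A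
              ((TensorProduct.assoc k A (A ⊗[k] A) A).toLinearMap (q ⊗ₜ z)))) = q ⊗ₜ (x ⊗ₜ z) := by
            induction q with
            | zero => simp
            | add x y hx hy => simp only [map_add, TensorProduct.tmul_add, TensorProduct.add_tmul, hx, hy]
            | tmul x q =>
              induction q with
              | zero => simp
              | add x y hx hy => simp only [map_add, TensorProduct.tmul_add, TensorProduct.add_tmul, hx, hy]
              | tmul y z => simp [σ]
          have h' : σ (expandMid k A (x ⊗ₜ (y ⊗ₜ z))) = comul₃ k A y ⊗ₜ (x ⊗ₜ z) := h _
          rw [h', ydTwist_tmul]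
          simp [Q, sandwich_tmul]
  have key2 (t : W ⊗[k] A) (p : A ⊗[k] (A ⊗[k] A)) :
      (comul (R := k) (A := A)).lTensor (W ⊗[k] A) (ydTwist (TensorProduct.mk k W A) t p) =
        (TensorProduct.assoc k (W ⊗[k] A) A A) (Q ((TensorProduct.assoc k W A A).symm
          ((comul (R := k) (A := A)).lTensor W t)) (σ (expandEnds k A p))) := by
    induction t with
    | zero => simp
    | add x y hx hy => simp only [map_add, LinearMap.add_apply, hx, hy]
    | tmul w c =>
      induction p with
      | zero => simp
      | add x y hx hy => simp only [map_add, hx, hy]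
      | tmul x p =>
        induction p with
        | zero => simp
        | add x y hx hy => simp only [map_add, TensorProduct.tmul_add, hx, hy]
        | tmul y z =>
          have h (c x z : A ⊗[k] A) : (w ⊗ₜ[k] y) ⊗ₜ[k]
              ((TensorProduct.map (antipode k) (antipode k) (TensorProduct.comm k A A x)) * c * z) =
              (TensorProduct.assoc k (W ⊗[k] A) A A) (Q ((TensorProduct.assoc k W A A).symm
                (w ⊗ₜ c)) (σ (TensorProduct.assoc k A A _ (x ⊗ₜ (y ⊗ₜ z))))) := by
            induction c with
            | zero => simp
            | add x y hx hy =>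
              simp only [map_add, TensorProduct.tmul_add, LinearMap.add_apply, mul_add, add_mul, hx, hy]
            | tmul c c' =>
              induction x with
              | zero => simp
              | add x y hx hy =>
                simp only [map_add, TensorProduct.tmul_add, TensorProduct.add_tmul, add_mul, hx, hy]
              | tmul x x' =>
                induction z with
                | zero => simp
                | add x y hx hy => simp only [map_add, TensorProduct.tmul_add, mul_add, hx, hy]
                | tmul z z' => simp [Q, σ, sandwich_tmul, ydTwist_tmul]
          rw [ydTwist_tmul, LinearMap.lTensor_tmul, Bialgebra.comul_mul, Bialgebra.comul_mul,
            comul_antipode]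
          exact h _ _ _
  have h3 := LinearMap.congr_fun (expand_comul₃ (k := k) (A := A))
  have h4 := LinearMap.congr_fun ρ.coassoc
  refine TensorProduct.ext' fun w a => ?_
  simp only [LinearMap.comp_apply, boxCoact_tmul, key1, key2] at h3 h4 ⊢
  rw [h3, ← h4]
  simp

/-- The free Yetter-Drinfeld module `W ⊠ A` on a right comodule `W`. -/
noncomputable abbrev YD.box (k A W : Type u) [Field k] [Ring A] [HopfAlgebra k A] [AddCommGroup W]
    [Module k W] (ρ : RightCoaction k A W) : YD k A where
  carrier := W ⊗[k] A
  right :=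
    { act := boxAct k A W
      act_one := fun v => by
        induction v with
        | zero => simp
        | add x y hx hy => simp [hx, hy]
        | tmul w c => simp
      act_mul := box_act_mul }
  co :=
    { coact := boxCoact ρ.coact
      coassoc := box_coassoc ρ
      counit := box_counit ρ }
  compat := box_compat ρ.coact

end Box
end Hopf

namespace YD

open Coalgebra HopfAlgebra

variable {k A : Type u} [Field k] [Ring A] [HopfAlgebra k A]

theorem trivial_compat (v : k) (a : A) :
    (TensorProduct.mk k k A).flip 1 ((LinearMap.mul k k).compl₂ (counit (R := k) (A := A)) v a) =
      ydTwist ((LinearMap.mul k k).compl₂ (counit (R := k) (A := A)))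
        ((TensorProduct.mk k k A).flip 1 v) (comul₃ k A a) := by
  have key (p : A ⊗[k] (A ⊗[k] A)) :
      ydTwist ((LinearMap.mul k k).compl₂ (counit (R := k) (A := A)))
        ((TensorProduct.mk k k A).flip 1 v) p =
      v ⊗ₜ LinearMap.mul' k A (TensorProduct.map (antipode k)
        ((TensorProduct.lid k A).toLinearMap ∘ₗ (counit (R := k) (A := A)).rTensor A) p) := by
    induction p with
    | zero => simp
    | add x y hx hy => simp only [map_add, TensorProduct.tmul_add, hx, hy]
    | tmul x p =>
      induction p with
      | zero => simp
      | add x y hx hy => simp only [map_add, TensorProduct.tmul_add, hx, hy]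
      | tmul y z =>
        simp only [LinearMap.flip_apply, TensorProduct.mk_apply, ydTwist_tmul]
        simp [mul_comm v, TensorProduct.tmul_smul, TensorProduct.smul_tmul']
  have h : (TensorProduct.map (antipode k)
        ((TensorProduct.lid k A).toLinearMap ∘ₗ (counit (R := k) (A := A)).rTensor A)) ∘ₗ
          comul₃ k A = (antipode k).rTensor A ∘ₗ comul (R := k) := by
    rw [comul₃, ← LinearMap.comp_assoc, LinearMap.map_comp_lTensor, LinearMap.comp_assoc,
      rTensor_counit_comp_comul, LinearMap.rTensor]
    congr 2
    ext; simp
  rw [key, ← LinearMap.comp_apply (TensorProduct.map _ _), h, LinearMap.comp_apply,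
    mul_antipode_rTensor_comul_apply]
  simp [Algebra.algebraMap_eq_smul_one, mul_comm v, TensorProduct.smul_tmul']

/-- The trivial Yetter-Drinfeld module: `c ← a = ε(a) c` and `c ↦ c ⊗ 1`. -/
noncomputable abbrev trivial (k A : Type u) [Field k] [Ring A] [HopfAlgebra k A] : YD k A where
  carrier := k
  right :=
    { act := (LinearMap.mul k k).compl₂ (counit (R := k) (A := A))
      act_one := by simp
      act_mul := by simp [mul_assoc] }
  co :=
    { coact := (TensorProduct.mk k k A).flip 1
      coassoc := by ext; simp [Algebra.TensorProduct.one_def]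
      counit := by ext; simp }
  compat := trivial_compat

theorem tilde_act {W : Type u} [AddCommGroup W] [Module k W]
    {X : YD k A} (f : W →ₗ[k] X.carrier) (v : W ⊗[k] A) (a : A) :
    TensorProduct.lift (X.act ∘ₗ f) (boxAct k A W v a) =
      X.act (TensorProduct.lift (X.act ∘ₗ f) v) a := by
  induction v with
  | zero => simp
  | add x y hx hy => simp only [map_add, LinearMap.add_apply, hx, hy]
  | tmul w b => simp [X.right.act_mul]

theorem tilde_coact {W : Type u} [AddCommGroup W] [Module k W] {ρ : RightCoaction k A W}
    {X : YD k A} (f : W →ₗ[k] X.carrier) (hf : X.coact ∘ₗ f = f.rTensor A ∘ₗ ρ.coact) (v : W ⊗[k] A) :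
    X.coact (TensorProduct.lift (X.act ∘ₗ f) v) =
      (TensorProduct.lift (X.act ∘ₗ f)).rTensor A (boxCoact ρ.coact v) := by
  have key (t : W ⊗[k] A) (p : A ⊗[k] (A ⊗[k] A)) :
      ydTwist X.act (f.rTensor A t) p =
      (TensorProduct.lift (X.act ∘ₗ f)).rTensor A (ydTwist (TensorProduct.mk k W A) t p) := by
    induction t with
    | zero => simp
    | add x y hx hy => simp only [map_add, LinearMap.add_apply, hx, hy]
    | tmul w c =>
      induction p with
      | zero => simp
      | add x y hx hy => simp only [map_add, hx, hy]
      | tmul x p =>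
        induction p with
        | zero => simp
        | add x y hx hy => simp only [map_add, TensorProduct.tmul_add, hx, hy]
        | tmul y z => simp [ydTwist_tmul]
  have hf' (w : W) : X.coact (f w) = f.rTensor A (ρ.coact w) := LinearMap.congr_fun hf w
  induction v with
  | zero => simp
  | add x y hx hy => simp only [map_add, hx, hy]
  | tmul w b => simp [X.compat, hf', key]

/-- The morphism `W ⊠ A ⟶ X`, `w ⊗ a ↦ f(w) ← a`, attached to a colinear map `f : W → X`. -/
noncomputable def tilde {W : Type u} [AddCommGroup W] [Module k W] {ρ : RightCoaction k A W}
    {X : YD k A} (f : W →ₗ[k] X.carrier) (hf : X.coact ∘ₗ f = f.rTensor A ∘ₗ ρ.coact) :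
    box k A W ρ ⟶ X where
  lin := TensorProduct.lift (X.act ∘ₗ f)
  map_act := tilde_act f
  map_coact := tilde_coact f hf

/-- The morphism `X ⊠ A ⟶ X`, `x ⊗ a ↦ x ← a`. -/
noncomputable def actHom (X : YD k A) : box k A X.carrier X.co ⟶ X :=
  tilde LinearMap.id (by simp)

theorem rTensor_boxAct {X Y : YD k A} (f : X ⟶ Y) (v : X.carrier ⊗[k] A) (a : A) :
    f.lin.rTensor A (boxAct k A X.carrier v a) =
      boxAct k A Y.carrier (f.lin.rTensor A v) a := by
  induction v with
  | zero => simp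
  | add x y hx hy => simp only [map_add, LinearMap.add_apply, hx, hy]
  | tmul w b => simp

theorem rTensor_boxCoact {X Y : YD k A} (f : X ⟶ Y) (v : X.carrier ⊗[k] A) :
    boxCoact Y.coact (f.lin.rTensor A v) =
      (f.lin.rTensor A).rTensor A (boxCoact X.coact v) := by
  have key (t : X.carrier ⊗[k] A) (p : A ⊗[k] (A ⊗[k] A)) :
      ydTwist (TensorProduct.mk k Y.carrier A) (f.lin.rTensor A t) p =
      (f.lin.rTensor A).rTensor A (ydTwist (TensorProduct.mk k X.carrier A) t p) := by
    induction t with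
    | zero => simp
    | add x y hx hy => simp only [map_add, LinearMap.add_apply, hx, hy]
    | tmul w c =>
      induction p with
      | zero => simp
      | add x y hx hy => simp only [map_add, hx, hy]
      | tmul x p =>
        induction p with
        | zero => simp
        | add x y hx hy => simp only [map_add, TensorProduct.tmul_add, hx, hy]
        | tmul y z => simp [ydTwist_tmul]
  induction v with
  | zero => simp
  | add x y hx hy => simp only [map_add, hx, hy]
  | tmul w b => simp [f.map_coact, key]

/-- The morphism `f ⊠ A : X ⊠ A ⟶ Y ⊠ A`. -/
noncomputable def boxMap {X Y : YD k A} (f : X ⟶ Y) :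
    box k A X.carrier X.co ⟶ box k A Y.carrier Y.co where
  lin := f.lin.rTensor A
  map_act := rTensor_boxAct f
  map_coact := rTensor_boxCoact f

theorem boxMap_comp {X Y Z : YD k A} (f : X ⟶ Y) (g : Y ⟶ Z) :
    boxMap f ≫ boxMap g = boxMap (f ≫ g) :=
  hom_ext (LinearMap.rTensor_comp A g.lin f.lin).symm

theorem boxMap_zero (X Y : YD k A) : boxMap (0 : X ⟶ Y) = 0 :=
  hom_ext (LinearMap.rTensor_zero A)

theorem boxMap_actHom {X Y : YD k A} (f : X ⟶ Y) :
    boxMap f ≫ actHom Y = actHom X ≫ f :=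
  hom_ext (TensorProduct.ext' fun x a => by simp [boxMap, actHom, tilde, f.map_act])

/-- The Yetter-Drinfeld module `A^{⊠ n}`, with underlying vector space `A^{⊗ n}`:
`A^{⊠ 0}` is the trivial one and `A^{⊠ (n+1)} = A^{⊠ n} ⊠ A`. -/
noncomputable abbrev boxPow (k A : Type u) [Field k] [Ring A] [HopfAlgebra k A] : ℕ → YD k A
  | 0 => trivial k A
  | n + 1 => box k A (boxPow k A n).carrier (boxPow k A n).co

/-- The map
`a₁ ⊗ ⋯ ⊗ aₙ₊₁ ↦ ε(a₁) a₂ ⊗ ⋯ ⊗ aₙ₊₁ + ∑ i = 1, …, n, (-1)^i a₁ ⊗ ⋯ ⊗ aᵢaᵢ₊₁ ⊗ ⋯ ⊗ aₙ₊₁`. -/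
noncomputable def barD (k A : Type u) [Field k] [Ring A] [HopfAlgebra k A] :
    (n : ℕ) → (boxPow k A (n + 1) ⟶ boxPow k A n)
  | 0 => actHom (trivial k A)
  | n + 1 => boxMap (barD k A n) + (-1 : k) ^ (n + 1) • actHom (boxPow k A (n + 1))

theorem barD_comp_barD (n : ℕ) : barD k A (n + 1) ≫ barD k A n = 0 := by
  induction n with
  | zero =>
    rw [barD, barD, Preadditive.add_comp, boxMap_actHom, Linear.smul_comp]
    simp only [zero_add, pow_one, neg_smul, one_smul]
    exact add_neg_cancel _
  | succ n ih =>
    rw [barD, Preadditive.add_comp, Linear.smul_comp, ← boxMap_actHom]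
    nth_rw 2 [barD]
    rw [Preadditive.comp_add, boxMap_comp, ih, boxMap_zero, Linear.comp_smul, pow_succ _ (n + 1)]
    simp

/-- The standard complex `⋯ → A^{⊠ 3} → A^{⊠ 2} → A^{⊠ 1}` of Yetter-Drinfeld modules. -/
noncomputable def barComplex (k A : Type u) [Field k] [Ring A] [HopfAlgebra k A] :
    ChainComplex (YD k A) ℕ :=
  ChainComplex.of (fun n => boxPow k A (n + 1)) (fun n => barD k A (n + 1))
    (fun n => barD_comp_barD (n + 1))

theorem barComplex_d (n : ℕ) : (barComplex k A).d (n + 1) n = barD k A (n + 1) :=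
  by simp [barComplex]

/-- The augmentation `A^{⊠ 1} → k` given by the counit. -/
noncomputable def barAug (k A : Type u) [Field k] [Ring A] [HopfAlgebra k A] :
    barComplex k A ⟶ (ChainComplex.single₀ (YD k A)).obj (trivial k A) :=
  (ChainComplex.toSingle₀Equiv (barComplex k A) (trivial k A)).symm
    ⟨barD k A 0, by rw [barComplex_d]; exact barD_comp_barD 0⟩

/-- The standard complex, viewed as a projective resolution of the trivial module. -/
noncomputable def barResolution (hP : ∀ n, Projective ((barComplex k A).X n))
    (hQ : QuasiIso (barAug k A)) : ProjectiveResolution (trivial k A) where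
  complex := barComplex k A
  projective := hP
  π := barAug k A
  quasiIso := hQ

end YD


/-- An `A`-bimodule structure on a vector space `M`; `left a m` is `a · m` and `right.act m a` is
`m · a`. -/
structure Bimodule (k A M : Type u) [Field k] [Ring A] [Algebra k A]
    [AddCommGroup M] [Module k M] where
  left : A →ₗ[k] M →ₗ[k] M
  left_one : ∀ m, left 1 m = m
  left_mul : ∀ a b m, left (a * b) m = left a (left b m)
  right : RightAction k A M
  left_right : ∀ a m b, right.act (left a m) b = left a (right.act m b)

section Hochschild

open Coalgebra HopfAlgebra YD

variable {k A : Type u} [Field k] [Ring A] [HopfAlgebra k A]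

/-- The vector space `A^{⊗ n}`: `A^{⊗ 0} = k` and `A^{⊗ (n+1)} = A^{⊗ n} ⊗ A`. -/
abbrev TPow (k A : Type u) [Field k] [Ring A] [HopfAlgebra k A] (n : ℕ) : Type u :=
  (boxPow k A n).carrier

/-- The pure tensor `a₁ ⊗ ⋯ ⊗ aₙ`. -/
noncomputable def pureTensor (k : Type u) {A : Type u} [Field k] [Ring A] [HopfAlgebra k A] :
    (n : ℕ) → (Fin n → A) → TPow k A n
  | 0, _ => (1 : k)
  | n + 1, a => pureTensor k n (Fin.init a) ⊗ₜ[k] a (Fin.last n)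

/-- The isomorphism `A^{⊗ (n+1)} → A ⊗ A^{⊗ n}` splitting off the first factor. -/
noncomputable def splitFirst (k A : Type u) [Field k] [Ring A] [HopfAlgebra k A] :
    (n : ℕ) → (TPow k A (n + 1) →ₗ[k] A ⊗[k] TPow k A n)
  | 0 => (TensorProduct.comm k k A).toLinearMap
  | n + 1 => (TensorProduct.assoc k A (TPow k A n) A).toLinearMap ∘ₗ (splitFirst k A n).rTensor A

/-- The map `a₁ ⊗ ⋯ ⊗ aₙ₊₁ ↦ ∑ i = 1, …, n, (-1)^i a₁ ⊗ ⋯ ⊗ aᵢaᵢ₊₁ ⊗ ⋯ ⊗ aₙ₊₁`. -/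
noncomputable def innerFaces (k A : Type u) [Field k] [Ring A] [HopfAlgebra k A] :
    (n : ℕ) → (TPow k A (n + 1) →ₗ[k] TPow k A n)
  | 0 => 0
  | n + 1 => (innerFaces k A n).rTensor A +
      (-1 : k) ^ (n + 1) • TensorProduct.lift (boxAct k A (TPow k A n))

variable {M : Type u} [AddCommGroup M] [Module k M]

/-- The Hochschild differential `Hom(A^{⊗ n}, M) → Hom(A^{⊗ (n+1)}, M)`:
`∂f(a₁ ⊗ ⋯ ⊗ aₙ₊₁) = a₁ · f(a₂ ⊗ ⋯ ⊗ aₙ₊₁) + ∑ i = 1, …, n, (-1)^i f(a₁ ⊗ ⋯ ⊗ aᵢaᵢ₊₁ ⊗ ⋯ ⊗ aₙ₊₁)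
  + (-1)^(n+1) f(a₁ ⊗ ⋯ ⊗ aₙ) · aₙ₊₁`. -/
noncomputable def hochschildD (B : Bimodule k A M) (n : ℕ) :
    (TPow k A n →ₗ[k] M) →ₗ[k] (TPow k A (n + 1) →ₗ[k] M) where
  toFun f := TensorProduct.lift B.left ∘ₗ f.lTensor A ∘ₗ splitFirst k A n + f ∘ₗ innerFaces k A n +
    (-1 : k) ^ (n + 1) • TensorProduct.lift (B.right.act ∘ₗ f)
  map_add' f g := by
    refine LinearMap.ext fun x => ?_
    have h : TensorProduct.lift (B.right.act ∘ₗ (f + g)) =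
        TensorProduct.lift (B.right.act ∘ₗ f) + TensorProduct.lift (B.right.act ∘ₗ g) := by
      ext; simp
    rw [h]
    simp only [LinearMap.add_apply, LinearMap.comp_apply, LinearMap.lTensor_add, map_add, smul_add]
    abel
  map_smul' c f := by
    refine LinearMap.ext fun x => ?_
    have h : TensorProduct.lift (B.right.act ∘ₗ (c • f)) =
        c • TensorProduct.lift (B.right.act ∘ₗ f) := by
      ext; simp
    rw [h]
    simp only [LinearMap.add_apply, LinearMap.comp_apply, LinearMap.lTensor_smul, map_smul,
      smul_add, LinearMap.smul_apply, RingHom.id_apply, smul_comm c]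

theorem splitFirst_pureTensor (n : ℕ) (a : Fin (n + 1) → A) :
    splitFirst k A n (pureTensor k (n + 1) a) = a 0 ⊗ₜ pureTensor k n (Fin.tail a) := by
  induction n with
  | zero => rfl
  | succ n ih =>
    change TensorProduct.assoc k A (TPow k A n) A
      (splitFirst k A n (pureTensor k (n + 1) (Fin.init a)) ⊗ₜ a (Fin.last (n + 1))) = _
    rw [ih]
    rfl

theorem innerFaces_pureTensor (n : ℕ) (a : Fin (n + 1) → A) :
    innerFaces k A n (pureTensor k (n + 1) a) =
      ∑ i : Fin n, (-1 : k) ^ ((i : ℕ) + 1) •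
        pureTensor k n (Fin.contractNth i.castSucc (· * ·) a) := by
  induction n with
  | zero => rfl
  | succ n ih =>
    change innerFaces k A n (pureTensor k (n + 1) (Fin.init a)) ⊗ₜ[k] a (Fin.last (n + 1)) +
      (-1 : k) ^ (n + 1) • (pureTensor k n (Fin.init (Fin.init a)) ⊗ₜ[k]
        (Fin.init a (Fin.last n) * a (Fin.last (n + 1)))) = _
    have h1 (i : Fin n) : pureTensor k (n + 1) (Fin.contractNth i.castSucc.castSucc (· * ·) a) =
        pureTensor k n (Fin.contractNth i.castSucc (· * ·) (Fin.init a)) ⊗ₜ[k]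
          a (Fin.last (n + 1)) := by
      change pureTensor k n (Fin.init (Fin.contractNth i.castSucc.castSucc (· * ·) a)) ⊗ₜ[k]
        (Fin.contractNth i.castSucc.castSucc (· * ·) a (Fin.last n)) = _
      refine congrArg₂ (fun x y => x ⊗ₜ[k] y) (congrArg _ (funext fun j => rfl)) ?_
      have := i.2
      simp only [Fin.contractNth, Fin.val_castSucc, Fin.val_last]
      rw [if_neg (by omega), if_neg (by omega), Fin.succ_last]
    have h2 : pureTensor k (n + 1) (Fin.contractNth (Fin.last n).castSucc (· * ·) a) =
        pureTensor k n (Fin.init (Fin.init a)) ⊗ₜ[k]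
          (Fin.init a (Fin.last n) * a (Fin.last (n + 1))) := by
      change pureTensor k n (Fin.init (Fin.contractNth (Fin.last n).castSucc (· * ·) a)) ⊗ₜ[k]
        (Fin.contractNth (Fin.last n).castSucc (· * ·) a (Fin.last n)) = _
      refine congrArg₂ (fun x y => x ⊗ₜ[k] y) (congrArg _ (funext fun j => ?_)) ?_
      · have := j.2
        simp only [Fin.init, Fin.contractNth, Fin.val_castSucc, Fin.val_last]
        rw [if_pos (by omega)]
      · simp [Fin.contractNth, Fin.init]
    rw [Fin.sum_univ_castSucc, h2, ih, TensorProduct.sum_tmul]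
    refine congrArg₂ (· + ·) (Finset.sum_congr rfl fun i _ => ?_) rfl
    rw [h1, ← TensorProduct.smul_tmul']
    rfl

/-- The explicit formula for the Hochschild differential on pure tensors. -/
theorem hochschildD_pureTensor (B : Bimodule k A M) (n : ℕ) (f : TPow k A n →ₗ[k] M)
    (a : Fin (n + 1) → A) :
    hochschildD B n f (pureTensor k (n + 1) a) =
      B.left (a 0) (f (pureTensor k n (Fin.tail a))) +
      ∑ i : Fin n, (-1 : k) ^ ((i : ℕ) + 1) •
        f (pureTensor k n (Fin.contractNth i.castSucc (· * ·) a)) +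
      (-1 : k) ^ (n + 1) • B.right.act (f (pureTensor k n (Fin.init a))) (a (Fin.last n)) := by
  change TensorProduct.lift B.left (f.lTensor A (splitFirst k A n (pureTensor k (n + 1) a))) +
    f (innerFaces k A n (pureTensor k (n + 1) a)) +
    (-1 : k) ^ (n + 1) • TensorProduct.lift (B.right.act ∘ₗ f) (pureTensor k (n + 1) a) = _
  rw [splitFirst_pureTensor, innerFaces_pureTensor, map_sum]
  simp only [map_smul]
  rfl

/-- Hochschild cocycles. -/
noncomputable def cocycles (B : Bimodule k A M) (n : ℕ) : Submodule k (TPow k A n →ₗ[k] M) :=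
  LinearMap.ker (hochschildD B n)

/-- Hochschild coboundaries. -/
noncomputable def coboundaries (B : Bimodule k A M) :
    (n : ℕ) → Submodule k (TPow k A n →ₗ[k] M)
  | 0 => ⊥
  | n + 1 => LinearMap.range (hochschildD B n)

/-- The Hochschild cohomology `Hⁿ(A, M)`: cocycles modulo coboundaries. -/
abbrev HochschildCohomology (B : Bimodule k A M) (n : ℕ) : Type u :=
  cocycles B n ⧸ (coboundaries B n).submoduleOf (cocycles B n)

/-- The bimodule `_ε V`: the right action of `V`, and the left action through the counit. -/
noncomputable def epsBimodule (V : YD k A) : Bimodule k A V.carrier where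
  left := (LinearMap.lsmul k V.carrier) ∘ₗ counit (R := k) (A := A)
  left_one := by simp
  left_mul a b m := by simp [mul_smul, smul_comm (counit (R := k) a)]
  right := V.right
  left_right := by simp

/-- `Hom^A(A^{⊠ n}, V)`: the colinear maps. -/
noncomputable def colinearCochains (V : YD k A) (n : ℕ) :
    Submodule k (TPow k A n →ₗ[k] V.carrier) where
  carrier := {f | V.coact ∘ₗ f = f.rTensor A ∘ₗ (boxPow k A n).coact}
  zero_mem' := by simp
  add_mem' := fun {f g} hf hg => by
    change V.coact ∘ₗ (f + g) = (f + g).rTensor A ∘ₗ (boxPow k A n).coact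
    change V.coact ∘ₗ f = f.rTensor A ∘ₗ (boxPow k A n).coact at hf
    change V.coact ∘ₗ g = g.rTensor A ∘ₗ (boxPow k A n).coact at hg
    rw [LinearMap.comp_add, hf, hg, LinearMap.rTensor_add, LinearMap.add_comp]
  smul_mem' := fun c f hf => by
    change V.coact ∘ₗ (c • f) = (c • f).rTensor A ∘ₗ (boxPow k A n).coact
    change V.coact ∘ₗ f = f.rTensor A ∘ₗ (boxPow k A n).coact at hf
    rw [LinearMap.comp_smul, hf, LinearMap.rTensor_smul, LinearMap.smul_comp]

/-- The cocycles of the subcomplex `Hom^A(A^{⊠ •}, V)` of the Hochschild complex of `_ε V`. -/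
noncomputable def colinearCocycles (V : YD k A) (n : ℕ) :
    Submodule k (TPow k A n →ₗ[k] V.carrier) :=
  colinearCochains V n ⊓ cocycles (epsBimodule V) n

/-- The coboundaries of the subcomplex `Hom^A(A^{⊠ •}, V)`. -/
noncomputable def colinearCoboundaries (V : YD k A) :
    (n : ℕ) → Submodule k (TPow k A n →ₗ[k] V.carrier)
  | 0 => ⊥
  | n + 1 => (colinearCochains V n).map (hochschildD (epsBimodule V) n)

/-- The `n`-th cohomology of the complex `Hom^A(A^{⊠ •}, V)`. -/
abbrev ColinearCohomology (V : YD k A) (n : ℕ) : Type u :=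
  colinearCocycles V n ⧸ (colinearCoboundaries V n).submoduleOf (colinearCocycles V n)

theorem colinearCoboundaries_le (V : YD k A) (n : ℕ) :
    colinearCoboundaries V n ≤ coboundaries (epsBimodule V) n := by
  cases n with
  | zero => exact le_rfl
  | succ n => exact LinearMap.map_le_range

/-- The map induced in cohomology by the inclusion of the complex `Hom^A(A^{⊠ •}, V)` into the
Hochschild complex of `_ε V`. -/
noncomputable def colinearToHochschild (V : YD k A) (n : ℕ) :
    ColinearCohomology V n →ₗ[k] HochschildCohomology (epsBimodule V) n :=
  Submodule.mapQ _ _ (Submodule.inclusion inf_le_right)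
    (fun _ hx => colinearCoboundaries_le V n hx)

theorem barD_lin (n : ℕ) : (barD k A n).lin =
    ((TensorProduct.lid k (TPow k A n)).toLinearMap ∘ₗ
      (counit (R := k) (A := A)).rTensor (TPow k A n)) ∘ₗ splitFirst k A n +
      innerFaces k A n := by
  induction n with
  | zero =>
    refine TensorProduct.ext' fun c a => ?_
    simp only [barD, actHom, tilde, splitFirst, innerFaces]
    simp only [LinearMap.comp_id, add_zero]
    change c * counit (R := k) a = counit (R := k) a * c
    exact mul_comm _ _
  | succ n ih =>
    have h : (((TensorProduct.lid k (TPow k A n)).toLinearMap ∘ₗ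
        (counit (R := k) (A := A)).rTensor (TPow k A n)).rTensor A) =
        ((TensorProduct.lid k (TPow k A n ⊗[k] A)).toLinearMap ∘ₗ
        (counit (R := k) (A := A)).rTensor (TPow k A n ⊗[k] A)) ∘ₗ
          (TensorProduct.assoc k A (TPow k A n) A).toLinearMap := by
      ext; simp [TensorProduct.smul_tmul']
    change (barD k A n).lin.rTensor A + (-1 : k) ^ (n + 1) •
      TensorProduct.lift (boxAct k A (TPow k A n) ∘ₗ LinearMap.id) = _
    rw [ih, LinearMap.rTensor_add, LinearMap.rTensor_comp, h, add_assoc]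
    rfl

theorem epsBimodule_barD (V : YD k A) (n : ℕ) (f : TPow k A n →ₗ[k] V.carrier) :
    hochschildD (epsBimodule V) n f =
      f ∘ₗ (barD k A n).lin + (-1 : k) ^ (n + 1) • TensorProduct.lift (V.act ∘ₗ f) := by
  have h : TensorProduct.lift (epsBimodule V).left ∘ₗ f.lTensor A =
      f ∘ₗ (TensorProduct.lid k (TPow k A n)).toLinearMap ∘ₗ
        (counit (R := k) (A := A)).rTensor (TPow k A n) := by
    ext a x
    simp [epsBimodule]
  rw [barD_lin, LinearMap.comp_add]
  change (TensorProduct.lift (epsBimodule V).left ∘ₗ f.lTensor A) ∘ₗ splitFirst k A n + _ + _ = _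
  rw [h]
  rfl

/-- The Yetter-Drinfeld morphism `A^{⊠ (n+1)} = A^{⊠ n} ⊠ A ⟶ V`, `x ⊗ a ↦ z(x) ← a`, attached to a
colinear cocycle `z`. -/
noncomputable def cocycleHom (V : YD k A) (n : ℕ) (z : colinearCocycles V n) :
    (barComplex k A).X n ⟶ V :=
  tilde (ρ := (boxPow k A n).co) z.1 z.2.1

theorem d_comp_cocycleHom (V : YD k A) (n : ℕ) (z : colinearCocycles V n) :
    (barComplex k A).d (n + 1) n ≫ cocycleHom V n z = 0 := by
  rw [barComplex_d]
  refine hom_ext (TensorProduct.ext' fun x a => ?_)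
  have hz : hochschildD (epsBimodule V) n z.1 x = 0 := LinearMap.congr_fun z.2.2 x
  rw [epsBimodule_barD] at hz
  change TensorProduct.lift (V.act ∘ₗ z.1) ((barD k A n).lin x ⊗ₜ a + (-1 : k) ^ (n + 1) •
    boxAct k A (TPow k A n) x a) = 0
  rw [map_add, map_smul, tilde_act, TensorProduct.lift.tmul]
  change V.act (z.1 ((barD k A n).lin x)) a +
    (-1 : k) ^ (n + 1) • V.act (TensorProduct.lift (V.act ∘ₗ z.1) x) a = 0
  rw [← LinearMap.smul_apply, ← map_smul, ← LinearMap.add_apply, ← map_add]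
  change V.act ((z.1 ∘ₗ (barD k A n).lin +
    (-1 : k) ^ (n + 1) • TensorProduct.lift (V.act ∘ₗ z.1)) x) a = 0
  rw [hz]
  simp

/-- The Gerstenhaber-Schack cohomology `Hⁿ_GS(A, V) = Extⁿ(k, V)`, the `Ext` being in the
abelian category of Yetter-Drinfeld modules. -/
abbrev GSCohomology (V : YD k A) (n : ℕ) : Type (u + 1) :=
  Abelian.Ext (trivial k A) V n

end Hochschild

end GS

/-! The functor `W ↦ W ⊠ A` is left adjoint to the forgetful functor from Yetter-Drinfeld modules to
comodules (`tilde`, `restrictBox`). Cosemisimplicity splits epimorphisms colinearly, so free modules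
are projective (`projective_box`). The standard complex consists of free modules and is contracted,
up to sign, by `x ↦ x ⊗ 1`, hence it resolves `k`. Under the adjunction, precomposition with its
differential becomes the Hochschild differential of `_ε V` on colinear cochains
(`restrictBox_barD_comp`), which identifies their cohomology with `Ext`.

Injectivity comes from a cochain retraction of the Hochschild complex onto the colinear subcomplex.
With a Haar functional `h`, a linear map `f` between comodules is averaged to `m ↦ f(m₀)₀ h(f(m₀)₁
S(m₁))`. Invariance of `h` makes the result colinear, and `h(1) = 1` makes averaging fix colinear
maps. Averaging commutes with precomposition by colinear maps, which covers all faces of the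
differential except the last one, `x ⊗ a ↦ f(x) ← a`. For that face the antipode produces a factor
`S²(a₁)` at the far right of the argument of `h`. It equals `a₁` because `S² = id`, and it can be
moved to the left and cancelled exactly when `h` is a trace (`contract_ydTwist`).

The trace property (`apply_mul_comm`) rests on Schur orthogonality. Let the dual of `A` act on `A`
by `a ↦ a₁ φ(a₂)`. The submodules are the subcomodules, so `A` is semisimple, with simple submodules
of finite dimension. On a simple `V`, Schur's lemma evaluates `h(v S(w))` and `h(S(w) v)` up to
constants `c` and `d`, and the antipode axioms give `c dim V = 1 = d dim V`. For non-isomorphic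
simple submodules both expressions vanish. -/

namespace GS

/-! ### Colinear splitting of surjections -/

section ColinearSection

variable {k A : Type u} [Field k] [Ring A] [HopfAlgebra k A]

/-- A surjective morphism of Yetter-Drinfeld modules over a cosemisimple Hopf algebra has a
colinear section. -/
theorem IsCosemisimple.exists_colinear_section (hA : IsCosemisimple k A) {X Y : YD k A}
    (f : X ⟶ Y) (hf : Function.Surjective f.lin) :
    ∃ s : Y.carrier →ₗ[k] X.carrier, f.lin ∘ₗ s = LinearMap.id ∧
      X.coact ∘ₗ s = s.rTensor A ∘ₗ Y.coact := by
  -- The section is the inverse of the restriction of `f` to a complementary subcomodule `W` of its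
  -- kernel.
  obtain ⟨W, hW, hc⟩ := hA X.carrier X.co (LinearMap.ker f.lin) fun v hv =>
    YD.coact_ker_mem f ⟨v, hv⟩
  have hbij : Function.Bijective (f.lin ∘ₗ W.subtype) := by
    constructor
    · rw [← LinearMap.ker_eq_bot, LinearMap.ker_eq_bot']
      intro w hw
      exact Subtype.ext (Submodule.disjoint_def.1 hc.disjoint w hw w.2)
    · intro y
      obtain ⟨x, rfl⟩ := hf y
      obtain ⟨a, ha, b, hb, rfl⟩ := Submodule.mem_sup.1 (hc.sup_eq_top ▸ Submodule.mem_top (x := x))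
      refine ⟨⟨b, hb⟩, ?_⟩
      simp [LinearMap.mem_ker.1 ha]
  let e := LinearEquiv.ofBijective _ hbij
  have hfs : f.lin ∘ₗ W.subtype ∘ₗ e.symm.toLinearMap = LinearMap.id :=
    LinearMap.ext fun y => e.apply_symm_apply y
  have hsf : (W.subtype ∘ₗ e.symm.toLinearMap) ∘ₗ f.lin ∘ₗ W.subtype = W.subtype :=
    LinearMap.ext fun w => congrArg Subtype.val (e.symm_apply_apply w)
  refine ⟨W.subtype ∘ₗ e.symm.toLinearMap, hfs, LinearMap.ext fun y => ?_⟩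
  -- Colinearity of the section: the coaction of a vector of `W` lies in `W ⊗ A`, where section
  -- after `f` is the identity.
  obtain ⟨t, ht⟩ := hW _ (e.symm y).2
  have hy : Y.coact y = f.lin.rTensor A (X.coact (e.symm y)) := by
    rw [← f.map_coact]
    exact congrArg _ (LinearMap.congr_fun hfs y).symm
  change X.coact (e.symm y) = (W.subtype ∘ₗ e.symm.toLinearMap).rTensor A (Y.coact y)
  rw [hy, show X.coact (e.symm y) = W.subtype.rTensor A t from ht.symm,
    ← LinearMap.rTensor_comp_apply, ← LinearMap.rTensor_comp_apply, LinearMap.comp_assoc, hsf]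

end ColinearSection

/-! ### Free Yetter-Drinfeld modules and the standard resolution -/

namespace YD

variable {k A : Type u} [Field k] [Ring A] [HopfAlgebra k A]

/-- Kernels and cokernels are formed on the underlying spaces, so exactness can be tested on vector
spaces. -/
instance : (forget k A).PreservesHomology where

theorem surjective_of_epi {V W : YD k A} (f : V ⟶ W) [Epi f] : Function.Surjective f.lin :=
  (ModuleCat.epi_iff_surjective ((forget k A).map f)).1 inferInstance

theorem epi_of_surjective {V W : YD k A} (f : V ⟶ W) (hf : Function.Surjective f.lin) : Epi f :=
  (forget k A).epi_of_epi_map ((ModuleCat.epi_iff_surjective ((forget k A).map f)).2 hf)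

theorem shortComplex_exact (S : ShortComplex (YD k A))
    (h : ∀ x, S.g.lin x = 0 → ∃ y, S.f.lin y = x) : S.Exact := by
  rw [← S.exact_map_iff_of_faithful (forget k A), ShortComplex.moduleCat_exact_iff]
  exact h

/-- The colinear map `w ↦ f(w ⊗ 1)` attached to a morphism `W ⊠ A ⟶ X`. -/
noncomputable def restrictBox {W : Type u} [AddCommGroup W] [Module k W] {ρ : RightCoaction k A W}
    {X : YD k A} (f : box k A W ρ ⟶ X) : W →ₗ[k] X.carrier :=
  f.lin ∘ₗ (TensorProduct.mk k W A).flip 1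

/-- The iterated comultiplication of `1` is `1 ⊗ 1 ⊗ 1`, so the twist by `S(a₁)` and `a₃`
disappears. This is the colinearity of `w ↦ w ⊗ 1`, the unit of the adjunction between free modules
and comodules. -/
theorem boxCoact_tmul_one {W : Type u} [AddCommGroup W] [Module k W] (r : W →ₗ[k] W ⊗[k] A) (w : W) :
    boxCoact r (w ⊗ₜ[k] (1 : A)) = ((TensorProduct.mk k W A).flip 1).rTensor A (r w) := by
  have key (t : W ⊗[k] A) : ydTwist (TensorProduct.mk k W A) t (comul₃ k A 1) =
      ((TensorProduct.mk k W A).flip 1).rTensor A t := by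
    induction t with
    | zero => simp
    | add x y hx hy => simp only [map_add, LinearMap.add_apply, hx, hy]
    | tmul w c => simp [comul₃, Algebra.TensorProduct.one_def, ydTwist_tmul]
  rw [boxCoact_tmul, key]

theorem restrictBox_colinear {W : Type u} [AddCommGroup W] [Module k W] {ρ : RightCoaction k A W}
    {X : YD k A} (f : box k A W ρ ⟶ X) :
    X.coact ∘ₗ restrictBox f = (restrictBox f).rTensor A ∘ₗ ρ.coact := by
  refine LinearMap.ext fun w => ?_
  change X.coact (f.lin (w ⊗ₜ 1)) = _
  rw [f.map_coact, restrictBox, LinearMap.rTensor_comp]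
  exact congrArg _ (boxCoact_tmul_one ρ.coact w)

theorem lin_tmul_eq {W : Type u} [AddCommGroup W] [Module k W] {ρ : RightCoaction k A W}
    {X : YD k A} (f : box k A W ρ ⟶ X) (w : W) (a : A) :
    f.lin (w ⊗ₜ a) = X.act (restrictBox f w) a := by
  have := f.map_act (w ⊗ₜ 1) a
  change f.lin (boxAct k A W (w ⊗ₜ 1) a) = _ at this
  rwa [boxAct_tmul, one_mul] at this

/-- Together with `restrictBox_tilde`, this is the bijection between morphisms `W ⊠ A ⟶ X` and
colinear maps `W → X`. -/
theorem tilde_restrictBox {W : Type u} [AddCommGroup W] [Module k W] {ρ : RightCoaction k A W}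
    {X : YD k A} (f : box k A W ρ ⟶ X) :
    tilde (ρ := ρ) (restrictBox f) (restrictBox_colinear f) = f :=
  hom_ext (TensorProduct.ext' fun w a => (lin_tmul_eq f w a).symm)

/-- By adjunction it suffices to lift a colinear map out of `W`, and composing with a colinear
section of the epimorphism does so. -/
theorem projective_box (hA : IsCosemisimple k A) {W : Type u} [AddCommGroup W] [Module k W]
    (ρ : RightCoaction k A W) : Projective (box k A W ρ) where
  factors {E X} f e _ := by
    obtain ⟨s, hs, hs'⟩ := hA.exists_colinear_section e (surjective_of_epi e)
    have hc : E.coact ∘ₗ s ∘ₗ restrictBox f = (s ∘ₗ restrictBox f).rTensor A ∘ₗ ρ.coact := by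
      rw [← LinearMap.comp_assoc, hs', LinearMap.comp_assoc, restrictBox_colinear,
        LinearMap.rTensor_comp, LinearMap.comp_assoc]
    refine ⟨tilde (ρ := ρ) _ hc, hom_ext (TensorProduct.ext' fun w a => ?_)⟩
    change e.lin (E.act (s (restrictBox f w)) a) = _
    rw [e.map_act, ← LinearMap.comp_apply e.lin s, hs, lin_tmul_eq]
    rfl

theorem projective_barComplex (hA : IsCosemisimple k A) (n : ℕ) :
    Projective ((barComplex k A).X n) :=
  projective_box hA (boxPow k A n).co

/-- This is the contracting homotopy identity: `x ↦ ± x ⊗ 1` splits the standard complex as a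
complex of vector spaces, which is enough for exactness. -/
theorem barD_succ_tmul_one (n : ℕ) (x : (boxPow k A (n + 1)).carrier) :
    (barD k A (n + 1)).lin (x ⊗ₜ (1 : A)) =
      (barD k A n).lin x ⊗ₜ 1 + (-1 : k) ^ (n + 1) • x := by
  change (barD k A n).lin x ⊗ₜ 1 + (-1 : k) ^ (n + 1) • boxAct k A _ x 1 = _
  rw [(box k A (TPow k A n) (boxPow k A n).co).right.act_one]

theorem exists_barD_eq (n : ℕ) (x : (boxPow k A (n + 1)).carrier) (hx : (barD k A n).lin x = 0) :
    ∃ y, (barD k A (n + 1)).lin y = x := by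
  refine ⟨(-1 : k) ^ (n + 1) • (x ⊗ₜ (1 : A)), ?_⟩
  rw [map_smul, barD_succ_tmul_one, hx, TensorProduct.zero_tmul, zero_add, smul_smul, ← mul_pow]
  simp

theorem barD_zero_surjective : Function.Surjective (barD k A 0).lin := fun c => by
  refine ⟨c ⊗ₜ (1 : A), ?_⟩
  change c * Coalgebra.counit (R := k) (1 : A) = c
  simp

theorem barAug_f_zero : (barAug k A).f 0 = barD k A 0 :=
  ChainComplex.toSingle₀Equiv_symm_apply_f_zero _ _

/-- The term of degree `n` is `A^{⊠ (n+1)}`. Degree `0` therefore asks for exactness of `A^{⊠ 2} →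
A^{⊠ 1} → k → 0`. In positive degrees the target is zero and the claim is exactness of the standard
complex. -/
theorem quasiIso_barAug : QuasiIso (barAug k A) := by
  refine ⟨fun n => ?_⟩
  cases n with
  | zero =>
    rw [ChainComplex.quasiIsoAt₀_iff, ShortComplex.quasiIso_iff_of_zeros' _ rfl rfl rfl]
    have hd : (barComplex k A).d 1 0 = barD k A 1 := barComplex_d 0
    refine ⟨shortComplex_exact _ fun x hx => ?_, epi_of_surjective _ ?_⟩
    · change ∃ y, ((barComplex k A).d 1 0).lin y = x
      change ((barAug k A).f 0).lin x = 0 at hx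
      rw [barAug_f_zero] at hx
      rw [hd]
      exact exists_barD_eq 0 x hx
    · change Function.Surjective ((barAug k A).f 0).lin
      rw [barAug_f_zero]
      exact barD_zero_surjective
  | succ n =>
    rw [quasiIsoAt_iff_exactAt']
    · rw [HomologicalComplex.exactAt_iff' _ (n + 2) (n + 1) n (by simp) (by simp)]
      refine shortComplex_exact _ fun x hx => ?_
      change ∃ y, ((barComplex k A).d (n + 2) (n + 1)).lin y = x
      change ((barComplex k A).d (n + 1) n).lin x = 0 at hx
      rw [barComplex_d] at hx ⊢
      exact exists_barD_eq (n + 1) x hx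
    · apply ChainComplex.exactAt_succ_single_obj

end YD
end GS

/-! ### Classes in `Ext` defined by a projective resolution -/

namespace CategoryTheory.ProjectiveResolution

open Abelian CochainComplex HomComplex

variable {C : Type*} [Category* C] [Abelian C] [HasExt C] {X Y : C}
  (R : ProjectiveResolution X)

/-- A coboundary would come from a map out of the term of cohomological degree `1`, and this term
vanishes because the resolution lives in degrees `≤ 0`. -/
theorem extMk_zero_eq_zero_iff (f : R.complex.X 0 ⟶ Y) (m : ℕ) (hm : 0 + 1 = m)
    (hf : R.complex.d m 0 ≫ f = 0) : R.extMk f m hm hf = 0 ↔ f = 0 := by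
  refine ⟨fun h => ?_, fun h => by subst h; exact R.extMk_zero m hm⟩
  rw [← R.extEquivCohomologyClass.apply_eq_iff_eq, extEquivCohomologyClass_extMk,
    extEquivCohomologyClass_zero, CohomologyClass.mk_eq_zero_iff,
    Cocycle.toSingleMk_mem_coboundaries_iff _ _ _ _ _ 1 (by simp)] at h
  obtain ⟨g, hg⟩ := h
  have h1 : g = 0 := (R.cochainComplex.isZero_of_isStrictlyLE 0 1).eq_of_src _ _
  rw [h1, Limits.comp_zero] at hg
  exact (cancel_epi (R.cochainComplexXIso (-(0 : ℕ)) 0 rfl).hom).1 (by rw [← hg]; simp)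

theorem smul_extMk {k : Type*} [Ring k] [Linear k C] {n : ℕ} (c : k) (f : R.complex.X n ⟶ Y)
    (m : ℕ) (hm : n + 1 = m) (hf : R.complex.d m n ≫ f = 0) :
    c • R.extMk f m hm hf = R.extMk (c • f) m hm (by simp [hf]) := by
  rw [Ext.smul_eq_comp_mk₀, extMk_comp_mk₀]
  simp

theorem extMk_congr {n : ℕ} {f g : R.complex.X n ⟶ Y} (h : f = g) (m : ℕ) (hm : n + 1 = m)
    (hf : R.complex.d m n ≫ f = 0) (hg : R.complex.d m n ≫ g = 0) :
    R.extMk f m hm hf = R.extMk g m hm hg := by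
  subst h; rfl

end CategoryTheory.ProjectiveResolution

/-! ### Cohomology of colinear cochains as `Ext` -/

namespace GS

open YD

variable {k A : Type u} [Field k] [Ring A] [HopfAlgebra k A]

theorem restrictBox_tilde {W : Type u} [AddCommGroup W] [Module k W] {ρ : RightCoaction k A W}
    {X : YD k A} (f : W →ₗ[k] X.carrier) (hf : X.coact ∘ₗ f = f.rTensor A ∘ₗ ρ.coact) :
    restrictBox (tilde (ρ := ρ) f hf) = f := by
  refine LinearMap.ext fun w => ?_
  change X.act (f w) 1 = f w
  exact X.right.act_one _

theorem restrictBox_injective {W : Type u} [AddCommGroup W] [Module k W] {ρ : RightCoaction k A W}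
    {X : YD k A} {f g : box k A W ρ ⟶ X} (h : restrictBox f = restrictBox g) : f = g :=
  hom_ext (TensorProduct.ext' fun w a => by rw [lin_tmul_eq, lin_tmul_eq, h])

/-- Evaluating at `x ⊗ 1` splits the bar differential into the one of lower degree and `± x`.
Applied to the latter, `f` gives the last Hochschild face, because `f` is recovered from its
restriction by the action. -/
theorem restrictBox_barD_comp (V : YD k A) (n : ℕ) (f : boxPow k A (n + 1) ⟶ V) :
    restrictBox (barD k A (n + 1) ≫ f) = hochschildD (epsBimodule V) n (restrictBox f) := by
  refine LinearMap.ext fun x => ?_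
  have h : f.lin x = TensorProduct.lift (V.act ∘ₗ restrictBox f) x :=
    (LinearMap.congr_fun (congrArg Hom.lin (tilde_restrictBox f)) x).symm
  change f.lin ((barD k A (n + 1)).lin (x ⊗ₜ 1)) = _
  rw [epsBimodule_barD, barD_succ_tmul_one, map_add, map_smul, h]
  rfl

theorem cocycleHom_add (V : YD k A) (n : ℕ) (z w : colinearCocycles V n) :
    cocycleHom V n (z + w) = cocycleHom V n z + cocycleHom V n w :=
  hom_ext (TensorProduct.ext' fun x a => by
    change V.act (z.1 x + w.1 x) a = V.act (z.1 x) a + V.act (w.1 x) a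
    rw [map_add, LinearMap.add_apply])

theorem cocycleHom_smul (V : YD k A) (n : ℕ) (c : k) (z : colinearCocycles V n) :
    cocycleHom V n (c • z) = c • cocycleHom V n z :=
  hom_ext (TensorProduct.ext' fun x a => by
    change V.act (c • z.1 x) a = c • V.act (z.1 x) a
    rw [map_smul, LinearMap.smul_apply])

/-- The class in `Ext` of a colinear cocycle. -/
noncomputable def extClass (hP : ∀ n, Projective ((barComplex k A).X n))
    (hQ : QuasiIso (barAug k A)) (V : YD k A) (n : ℕ) :
    colinearCocycles V n →ₗ[k] GSCohomology V n where
  toFun z := (barResolution hP hQ).extMk (cocycleHom V n z) (n + 1) rfl (d_comp_cocycleHom V n z)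
  map_add' z w :=
    ((barResolution hP hQ).extMk_congr (cocycleHom_add V n z w) _ _ _ _).trans
      ((barResolution hP hQ).add_extMk (cocycleHom V n z) (cocycleHom V n w) _ _
        (d_comp_cocycleHom V n z) (d_comp_cocycleHom V n w)).symm
  map_smul' c z :=
    ((barResolution hP hQ).extMk_congr (cocycleHom_smul V n c z) _ _ _ _).trans
      ((barResolution hP hQ).smul_extMk c (cocycleHom V n z) _ _ (d_comp_cocycleHom V n z)).symm

theorem restrictBox_cocycleHom (V : YD k A) (n : ℕ) (z : colinearCocycles V n) :
    restrictBox (ρ := (boxPow k A n).co) (cocycleHom V n z) = z.1 :=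
  restrictBox_tilde z.1 z.2.1

/-- In positive degree the class vanishes exactly when the cocycle morphism factors through the
differential, and by adjunction such a factorization is a colinear primitive. In degree `0` there is
nothing to divide by on either side. -/
theorem extClass_eq_zero_iff (hP : ∀ n, Projective ((barComplex k A).X n))
    (hQ : QuasiIso (barAug k A)) (V : YD k A) (n : ℕ) (z : colinearCocycles V n) :
    extClass hP hQ V n z = 0 ↔ z.1 ∈ colinearCoboundaries V n := by
  cases n with
  | zero =>
    refine ((barResolution hP hQ).extMk_zero_eq_zero_iff (cocycleHom V 0 z) _ rfl
      (d_comp_cocycleHom V 0 z)).trans ⟨fun h => ?_, fun h => ?_⟩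
    · change z.1 = 0
      rw [← restrictBox_cocycleHom, h]
      rfl
    · have h : z = 0 := Subtype.ext h
      subst h
      refine restrictBox_injective (ρ := (boxPow k A 0).co) ?_
      rw [restrictBox_cocycleHom]
      rfl
  | succ n =>
    refine ((barResolution hP hQ).extMk_eq_zero_iff (cocycleHom V (n + 1) z) _ rfl
      (d_comp_cocycleHom V (n + 1) z) n rfl).trans
      ⟨fun ⟨g, hg⟩ => ?_, fun ⟨g, hg, h⟩ => ?_⟩
    · change (barComplex k A).d (n + 1) n ≫ g = _ at hg
      rw [barComplex_d] at hg
      exact ⟨restrictBox (ρ := (boxPow k A n).co) g,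
        restrictBox_colinear (ρ := (boxPow k A n).co) g, (restrictBox_barD_comp V n g).symm.trans
          ((congrArg (restrictBox (ρ := (boxPow k A (n + 1)).co)) hg).trans
            (restrictBox_cocycleHom V (n + 1) z))⟩
    · refine ⟨tilde (ρ := (boxPow k A n).co) g hg, ?_⟩
      change (barComplex k A).d (n + 1) n ≫ tilde (ρ := (boxPow k A n).co) g hg = _
      rw [barComplex_d]
      refine restrictBox_injective (ρ := (boxPow k A (n + 1)).co) ?_
      refine (restrictBox_barD_comp V n _).trans ?_
      rw [restrictBox_cocycleHom, ← h]
      exact congrArg _ (restrictBox_tilde g hg)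

/-- Each class is represented by a morphism killed by the differential; its restriction is a
colinear cocycle that gives the morphism back. -/
theorem extClass_surjective (hP : ∀ n, Projective ((barComplex k A).X n))
    (hQ : QuasiIso (barAug k A)) (V : YD k A) (n : ℕ) :
    Function.Surjective (extClass hP hQ V n) := fun α => by
  obtain ⟨f, hf, rfl⟩ := (barResolution hP hQ).extMk_surjective α (n + 1) rfl
  change (barComplex k A).d (n + 1) n ≫ f = 0 at hf
  rw [barComplex_d] at hf
  have hz : restrictBox (ρ := (boxPow k A n).co) f ∈ colinearCocycles V n :=
    ⟨restrictBox_colinear (ρ := (boxPow k A n).co) f, (restrictBox_barD_comp V n f).symm.trans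
      (congrArg (restrictBox (ρ := (boxPow k A (n + 1)).co)) hf)⟩
  exact ⟨⟨_, hz⟩, (barResolution hP hQ).extMk_congr (tilde_restrictBox (ρ := (boxPow k A n).co) f)
    _ _ (d_comp_cocycleHom V n ⟨_, hz⟩) _⟩

/-- The comparison isomorphism from the cohomology of the complex of colinear maps. -/
noncomputable def colinearEquivGS (hP : ∀ n, Projective ((barComplex k A).X n))
    (hQ : QuasiIso (barAug k A)) (V : YD k A) (n : ℕ) :
    ColinearCohomology V n ≃ₗ[k] GSCohomology V n :=
  (Submodule.quotEquivOfEq _ _ (by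
    ext z
    exact (extClass_eq_zero_iff hP hQ V n z).symm)).trans
    ((extClass hP hQ V n).quotKerEquivOfSurjective (extClass_surjective hP hQ V n))

theorem colinearEquivGS_mk (hP : ∀ n, Projective ((barComplex k A).X n))
    (hQ : QuasiIso (barAug k A)) (V : YD k A) (n : ℕ) (z : colinearCocycles V n) :
    colinearEquivGS hP hQ V n (Submodule.Quotient.mk z) = extClass hP hQ V n z := rfl

end GS

/-! ### The dual algebra acting on `A` by translations -/

namespace GS

open Coalgebra HopfAlgebra WithConv

section Hits

variable {k A : Type u} [Field k] [Ring A] [HopfAlgebra k A]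

/-- The map `a ↦ φ(a₍₁₎) a₍₂₎`. -/
noncomputable def leftHit (φ : A →ₗ[k] k) : A →ₗ[k] A :=
  (TensorProduct.lid k A).toLinearMap ∘ₗ φ.rTensor A ∘ₗ comul

/-- The map `a ↦ a₍₁₎ φ(a₍₂₎)`. -/
noncomputable def rightHit (φ : A →ₗ[k] k) : A →ₗ[k] A :=
  (TensorProduct.rid k A).toLinearMap ∘ₗ φ.lTensor A ∘ₗ comul

/-- Both sides are `φ(a₁) ψ(a₂)`. -/
theorem apply_leftHit (φ ψ : A →ₗ[k] k) (a : A) : ψ (leftHit φ a) = φ (rightHit ψ a) := by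
  simp only [leftHit, rightHit, LinearMap.comp_apply]
  induction comul (R := k) a with
  | zero => simp
  | add x y hx hy => simp only [map_add, hx, hy]
  | tmul x y => simp [mul_comm]

theorem leftHit_counit (a : A) : leftHit (counit (R := k)) a = a := by
  simp [leftHit]

theorem rightHit_counit (a : A) : rightHit (counit (R := k)) a = a := by
  simp [rightHit]

theorem counit_rightHit (φ : A →ₗ[k] k) (a : A) : counit (R := k) (rightHit φ a) = φ a := by
  rw [← apply_leftHit, leftHit_counit]

theorem counit_leftHit (φ : A →ₗ[k] k) (a : A) : counit (R := k) (leftHit φ a) = φ a := by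
  rw [apply_leftHit, rightHit_counit]

/-- By coassociativity both sides are `φ(a₁) a₂ ψ(a₃)`. -/
theorem leftHit_rightHit (φ ψ : A →ₗ[k] k) (a : A) :
    leftHit φ (rightHit ψ a) = rightHit ψ (leftHit φ a) := by
  let F : A ⊗[k] (A ⊗[k] A) →ₗ[k] A := (TensorProduct.lid k A).toLinearMap ∘ₗ
    TensorProduct.map φ ((TensorProduct.rid k A).toLinearMap ∘ₗ ψ.lTensor A)
  have h1 (t : A ⊗[k] A) : leftHit φ ((TensorProduct.rid k A) (ψ.lTensor A t)) =
      F (TensorProduct.assoc k A A A (comul.rTensor A t)) := by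
    induction t with
    | zero => simp
    | add x y hx hy => simp only [map_add, hx, hy]
    | tmul x y =>
      simp only [leftHit, LinearMap.comp_apply, LinearMap.lTensor_tmul, TensorProduct.rid_tmul,
        map_smul, LinearMap.rTensor_tmul, LinearEquiv.coe_coe]
      induction comul (R := k) x with
      | zero => simp
      | add x y hx hy => simp only [map_add, smul_add, TensorProduct.add_tmul, hx, hy]
      | tmul u v => simp [F, smul_comm (ψ y)]
  have h2 (t : A ⊗[k] A) : rightHit ψ ((TensorProduct.lid k A) (φ.rTensor A t)) =
      F (comul.lTensor A t) := by
    induction t with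
    | zero => simp
    | add x y hx hy => simp only [map_add, hx, hy]
    | tmul x y => simp [F, rightHit]
  change leftHit φ ((TensorProduct.rid k A) (ψ.lTensor A (comul a))) =
    rightHit ψ ((TensorProduct.lid k A) (φ.rTensor A (comul a)))
  rw [h1, h2, coassoc_apply]

theorem ext_dual {a b : A} (h : ∀ φ : A →ₗ[k] k, φ a = φ b) : a = b :=
  sub_eq_zero.1 ((Module.forall_dual_apply_eq_zero_iff k _).1 fun φ => by
    rw [map_sub, sub_eq_zero]; exact h φ)

/-- Apply an arbitrary `φ`: the right side becomes `ε(T(leftHit φ a)) = ε(leftHit φ (T a)) = φ(T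
a)`. With `eq_leftHit`, left and right translations are each other's commutants. -/
theorem eq_rightHit {T : A →ₗ[k] A} (h : ∀ (φ : A →ₗ[k] k) a, T (leftHit (k := k) φ a) = leftHit φ (T a)) (a : A) :
    T a = rightHit (counit ∘ₗ T) a :=
  ext_dual (k := k) fun φ => by
    rw [← apply_leftHit, LinearMap.comp_apply, h, counit_leftHit]

theorem eq_leftHit {T : A →ₗ[k] A} (h : ∀ (φ : A →ₗ[k] k) a, T (rightHit (k := k) φ a) = rightHit φ (T a)) (a : A) :
    T a = leftHit (counit ∘ₗ T) a :=
  ext_dual (k := k) fun φ => by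
    rw [apply_leftHit, LinearMap.comp_apply, h, counit_rightHit]

/-- Expanded along a basis of `A`, the tensor has as coefficients its slices by the coordinate
functionals. This turns stability under right translations into the subcomodule condition. -/
theorem mem_range_rTensor_subtype {V : Type u} [AddCommGroup V] [Module k V] {W : Submodule k V}
    {t : V ⊗[k] A} (h : ∀ φ : A →ₗ[k] k, TensorProduct.rid k V (φ.lTensor V t) ∈ W) :
    t ∈ LinearMap.range (W.subtype.rTensor A) := by
  classical
  let b := Module.Basis.ofVectorSpace k A
  let e := TensorProduct.equivFinsuppOfBasisRight (M := V) b
  rw [← e.symm_apply_apply t, TensorProduct.equivFinsuppOfBasisRight_symm_apply]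
  refine Submodule.sum_mem _ fun i _ => ?_
  rw [TensorProduct.equivFinsuppOfBasisRight_apply]
  exact ⟨⟨_, h (b.coord i)⟩ ⊗ₜ b i, rfl⟩

variable (k A) in
/-- The subalgebra of the operators `a ↦ a₍₁₎ φ(a₍₂₎)`. -/
noncomputable def hitSubalgebra : Subalgebra k (Module.End k A) :=
  -- Taking the commutant of the left translations gives closure under products at once; by
  -- `eq_rightHit` it contains only right translations.
  Subalgebra.centralizer k (Set.range leftHit)

variable (k A) in
/-- The algebra of the operators `a ↦ a₍₁₎ φ(a₍₂₎)`. -/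
def HitAlgebra : Type u := hitSubalgebra k A

noncomputable instance : Ring (HitAlgebra k A) := inferInstanceAs (Ring (hitSubalgebra k A))

noncomputable instance : Algebra k (HitAlgebra k A) :=
  inferInstanceAs (Algebra k (hitSubalgebra k A))

noncomputable instance : Module (HitAlgebra k A) A :=
  inferInstanceAs (Module (hitSubalgebra k A) A)

noncomputable instance : IsScalarTower k (HitAlgebra k A) A :=
  inferInstanceAs (IsScalarTower k (hitSubalgebra k A) A)

/-- The operator `a ↦ a₍₁₎ φ(a₍₂₎)` as an element of `HitAlgebra`. -/
noncomputable def HitAlgebra.ofDual (φ : A →ₗ[k] k) : HitAlgebra k A :=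
  ⟨rightHit φ, by
    rintro _ ⟨ψ, rfl⟩
    exact LinearMap.ext fun a => leftHit_rightHit ψ φ a⟩

theorem HitAlgebra.ofDual_smul (φ : A →ₗ[k] k) (a : A) : ofDual φ • a = rightHit φ a := rfl

theorem HitAlgebra.smul_leftHit (b : HitAlgebra k A) (φ : A →ₗ[k] k) (a : A) :
    b • leftHit φ a = leftHit φ (b • a) :=
  (LinearMap.congr_fun (b.2 (leftHit φ) ⟨φ, rfl⟩) a).symm

theorem HitAlgebra.exists_eq_ofDual (b : HitAlgebra k A) : ∃ φ : A →ₗ[k] k, b = ofDual φ :=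
  ⟨counit ∘ₗ b.1, Subtype.ext (LinearMap.ext (eq_rightHit fun φ a => b.smul_leftHit φ a))⟩

theorem rightHit_mem_of_mem {W : Submodule (HitAlgebra k A) A} {a : A} (φ : A →ₗ[k] k)
    (ha : a ∈ W) : rightHit φ a ∈ W :=
  W.smul_mem (HitAlgebra.ofDual φ) ha

/-- The operator `a ↦ φ(a₍₁₎) a₍₂₎` commutes with `HitAlgebra`. -/
noncomputable def leftHitLinear (φ : A →ₗ[k] k) : A →ₗ[HitAlgebra k A] A where
  __ := leftHit φ
  map_smul' b a := (b.smul_leftHit φ a).symm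

/-- The module endomorphisms of `A` are left translations. This produces explicit functionals from
retractions and from isomorphisms of simple submodules. -/
theorem hitAlgebra_linear_eq (T : A →ₗ[HitAlgebra k A] A) (a : A) :
    T a = leftHit (counit ∘ₗ T.restrictScalars k) a :=
  eq_leftHit (T := T.restrictScalars k) (fun φ a => T.map_smul (HitAlgebra.ofDual φ) a) a

theorem comul_mem_range (W : Submodule (HitAlgebra k A) A) {a : A} (ha : a ∈ W) :
    comul (R := k) a ∈ LinearMap.range ((W.restrictScalars k).subtype.rTensor A) :=
  mem_range_rTensor_subtype fun φ => rightHit_mem_of_mem φ ha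

variable (k A) in
/-- The right coaction of a coalgebra on itself. -/
noncomputable def regularCoaction : RightCoaction k A A where
  coact := comul
  coassoc := coassoc
  counit := lTensor_counit_comp_comul

/-- Submodules for `HitAlgebra` and subcomodules of the regular comodule are the same subspaces, so
complements carry over. -/
theorem IsCosemisimple.isSemisimpleModule (hA : IsCosemisimple k A) :
    IsSemisimpleModule (HitAlgebra k A) A where
  exists_isCompl W := by
    obtain ⟨W', hW', hc⟩ := hA A (regularCoaction k A) (W.restrictScalars k)
      fun w hw => comul_mem_range W hw
    let U : Submodule (HitAlgebra k A) A :=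
      { W' with
        smul_mem' := fun b a ha => by
          obtain ⟨φ, rfl⟩ := b.exists_eq_ofDual
          rw [HitAlgebra.ofDual_smul]
          obtain ⟨t, ht⟩ := hW' a ha
          change TensorProduct.rid k A (LinearMap.lTensor A _ (comul a)) ∈ W'
          rw [show comul a = _ from ht.symm]
          clear ht
          induction t with
          | zero => simp
          | add x y hx hy => simpa only [map_add] using W'.add_mem hx hy
          | tmul x y => simpa using W'.smul_mem _ x.2 }
    refine ⟨U, IsCompl.of_eq ?_ ?_⟩
    · refine (Submodule.eq_bot_iff _).2 fun x hx => ?_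
      exact Submodule.disjoint_def.1 hc.disjoint x hx.1 hx.2
    · refine (Submodule.eq_top_iff').2 fun x => ?_
      have hx : x ∈ W.restrictScalars k ⊔ W' := hc.sup_eq_top ▸ Submodule.mem_top
      obtain ⟨y, hy, z, hz, rfl⟩ := Submodule.mem_sup.1 hx
      exact Submodule.mem_sup.2 ⟨y, hy, z, hz, rfl⟩

/-- A nonzero `v` generates `V`, and all its right translates lie in the span of the finitely many
left factors of one expression of `Δ(v)`. -/
theorem finiteDimensional_of_isSimpleModule (V : Submodule (HitAlgebra k A) A)
    [IsSimpleModule (HitAlgebra k A) V] : FiniteDimensional k (V.restrictScalars k) := by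
  obtain ⟨v, hv, hv0⟩ := V.ne_bot_iff.1 (isSimpleModule_iff_isAtom.1 ‹_›).1
  have hV : Submodule.span (HitAlgebra k A) {v} = V :=
    ((isSimpleModule_iff_isAtom.1 ‹_›).le_iff_eq (by simpa using hv0)).1 (by simpa using hv)
  let r := Coalgebra.Repr.arbitrary k v
  have : FiniteDimensional k (Submodule.span k (r.left '' (r.index : Set _))) :=
    FiniteDimensional.span_of_finite k (r.index.finite_toSet.image _)
  refine Submodule.finiteDimensional_of_le (S₂ := Submodule.span k (r.left '' (r.index : Set _))) ?_
  intro x hx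
  have hx : x ∈ Submodule.span (HitAlgebra k A) {v} := hV ▸ hx
  obtain ⟨b, rfl⟩ := Submodule.mem_span_singleton.1 hx
  obtain ⟨φ, rfl⟩ := b.exists_eq_ofDual
  rw [HitAlgebra.ofDual_smul, rightHit, LinearMap.comp_apply, LinearMap.comp_apply, ← r.eq]
  simp only [map_sum]
  refine Submodule.sum_mem _ fun i hi => ?_
  simpa using Submodule.smul_mem _ _ (Submodule.subset_span (Set.mem_image_of_mem r.left hi))

end Hits
end GS

/-! ### The Haar functional -/

namespace GS

open Coalgebra HopfAlgebra WithConv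

section Haar

variable {k A : Type u} [Field k] [Ring A] [HopfAlgebra k A]

variable (k A) in
/-- A normalized two-sided invariant functional on a Hopf algebra. -/
structure HaarFunctional where
  toLin : A →ₗ[k] k
  map_one : toLin 1 = 1
  leftHit_eq : ∀ a, leftHit toLin a = algebraMap k A (toLin a)
  rightHit_eq : ∀ a, rightHit toLin a = algebraMap k A (toLin a)

theorem leftHit_add (φ ψ : A →ₗ[k] k) (a : A) :
    leftHit (φ + ψ) a = leftHit φ a + leftHit ψ a := by
  simp [leftHit, LinearMap.rTensor_add]

theorem leftHit_smul (c : k) (φ : A →ₗ[k] k) (a : A) : leftHit (c • φ) a = c • leftHit φ a := by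
  simp [leftHit, LinearMap.rTensor_smul]

theorem rightHit_add (φ ψ : A →ₗ[k] k) (a : A) :
    rightHit (φ + ψ) a = rightHit φ a + rightHit ψ a := by
  simp [rightHit, LinearMap.lTensor_add]

theorem rightHit_smul (c : k) (φ : A →ₗ[k] k) (a : A) : rightHit (c • φ) a = c • rightHit φ a := by
  simp [rightHit, LinearMap.lTensor_smul]

/-- The antipode reverses the comultiplication, so it exchanges left and right translations. -/
theorem antipode_leftHit (φ : A →ₗ[k] k) (a : A) :
    leftHit φ (antipode k a) = antipode k (rightHit (φ ∘ₗ antipode k) a) := by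
  simp only [leftHit, rightHit, LinearMap.comp_apply, comul_antipode]
  induction comul (R := k) a with
  | zero => simp
  | add x y hx hy => simp only [map_add, hx, hy]
  | tmul x y => simp

theorem rightHit_one (φ : A →ₗ[k] k) : rightHit φ 1 = algebraMap k A (φ 1) := by
  simp [rightHit, Algebra.TensorProduct.one_def, Algebra.algebraMap_eq_smul_one]

theorem antipode_algebraMap (c : k) : antipode k (algebraMap k A c) = algebraMap k A c := by
  simp [Algebra.algebraMap_eq_smul_one]

/-- The line `k · 1` is a submodule of the semisimple module `A`, hence has a linear retraction `T`.
Such a `T` is the left translation by `h = ε ∘ T`, and its taking values in `k · 1` is the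
invariance of `h`. -/
theorem IsCosemisimple.exists_leftHit_eq (hA : IsCosemisimple k A) :
    ∃ h : A →ₗ[k] k, h 1 = 1 ∧ ∀ a, leftHit h a = algebraMap k A (h a) := by
  have := hA.isSemisimpleModule
  let N : Submodule (HitAlgebra k A) A :=
    { LinearMap.range (Algebra.linearMap k A) with
      smul_mem' := by
        rintro b _ ⟨c, rfl⟩
        obtain ⟨φ, rfl⟩ := b.exists_eq_ofDual
        refine ⟨c * φ 1, ?_⟩
        rw [HitAlgebra.ofDual_smul]
        simp [Algebra.algebraMap_eq_smul_one, rightHit_one, smul_smul] }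
  obtain ⟨P, hP⟩ := IsSemisimpleModule.extension_property N.subtype N.injective_subtype
    (LinearMap.id (R := HitAlgebra k A) (M := N))
  let T : A →ₗ[HitAlgebra k A] A := N.subtype ∘ₗ P
  refine ⟨counit ∘ₗ T.restrictScalars k, ?_, fun a => ?_⟩
  · have h1 : T 1 = 1 := congrArg Subtype.val (LinearMap.congr_fun hP ⟨1, 1, by simp⟩)
    simp [h1]
  · rw [← hitAlgebra_linear_eq]
    obtain ⟨c, hc⟩ := (P a).2
    have hc : algebraMap k A c = T a := hc
    simp [← hc]

/-- Writing translations as convolution products with the identity lets the antipode, the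
convolution inverse of the identity, cancel them. -/
theorem leftHit_eq_convMul (φ : A →ₗ[k] k) :
    toConv (leftHit φ) = toConv (Algebra.linearMap k A ∘ₗ φ) * toConv LinearMap.id := by
  ext a
  change leftHit φ a = LinearMap.mul' k A (TensorProduct.map _ _ (comul a))
  rw [leftHit, LinearMap.comp_apply, LinearMap.comp_apply]
  induction comul (R := k) a with
  | zero => simp
  | add x y hx hy => simp only [map_add, hx, hy]
  | tmul x y => simp [Algebra.algebraMap_eq_smul_one]

theorem rightHit_eq_convMul (φ : A →ₗ[k] k) :
    toConv (rightHit φ) = toConv LinearMap.id * toConv (Algebra.linearMap k A ∘ₗ φ) := by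
  ext a
  change rightHit φ a = LinearMap.mul' k A (TensorProduct.map _ _ (comul a))
  rw [rightHit, LinearMap.comp_apply, LinearMap.comp_apply]
  induction comul (R := k) a with
  | zero => simp
  | add x y hx hy => simp only [map_add, hx, hy]
  | tmul x y => simp [Algebra.algebraMap_eq_smul_one]

theorem rightHit_comp_antipode (hS : antipode k (A := A) ∘ₗ antipode k = LinearMap.id)
    {h : A →ₗ[k] k} (hl : ∀ a, leftHit h a = algebraMap k A (h a)) (a : A) :
    rightHit (h ∘ₗ antipode k) a = algebraMap k A (h (antipode k a)) := by
  have h2 := congrArg (antipode k) (antipode_leftHit h a)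
  rw [hl, antipode_algebraMap] at h2
  exact (LinearMap.congr_fun hS _).symm.trans h2.symm

/-- Evaluate `h ⊗ (h ∘ S)` on `Δ(a)` in two ways: left invariance of `h` gives `h(a)`, and right
invariance of `h ∘ S` gives `h(S(a))`. -/
theorem apply_antipode_of_leftHit (hS : antipode k (A := A) ∘ₗ antipode k = LinearMap.id)
    {h : A →ₗ[k] k} (h1 : h 1 = 1) (hl : ∀ a, leftHit h a = algebraMap k A (h a)) (a : A) :
    h (antipode k a) = h a := by
  have h2 := apply_leftHit h (h ∘ₗ antipode k) a
  rw [hl, rightHit_comp_antipode hS hl] at h2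
  simpa [Algebra.algebraMap_eq_smul_one, h1] using h2.symm

theorem IsCosemisimple.nonempty_haar (hA : IsCosemisimple k A)
    (hS : antipode k (A := A) ∘ₗ antipode k = LinearMap.id) : Nonempty (HaarFunctional k A) := by
  obtain ⟨h, h1, hl⟩ := hA.exists_leftHit_eq
  have he : h ∘ₗ antipode k = h := LinearMap.ext (apply_antipode_of_leftHit hS h1 hl)
  refine ⟨⟨h, h1, hl, fun a => ?_⟩⟩
  have := rightHit_comp_antipode hS hl a
  rwa [he, apply_antipode_of_leftHit hS h1 hl] at this

namespace HaarFunctional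

variable (h : HaarFunctional k A)

theorem apply_antipode (hS : antipode k (A := A) ∘ₗ antipode k = LinearMap.id) (a : A) :
    h.toLin (antipode k a) = h.toLin a :=
  apply_antipode_of_leftHit hS h.map_one h.leftHit_eq a

/-- The functional `x ↦ h(v S(x))`. -/
noncomputable def mulAntipode (v : A) : A →ₗ[k] k :=
  h.toLin ∘ₗ LinearMap.mulLeft k v ∘ₗ antipode k

/-- The functional `x ↦ h(S(x) v)`. -/
noncomputable def antipodeMul (v : A) : A →ₗ[k] k :=
  h.toLin ∘ₗ LinearMap.mulRight k v ∘ₗ antipode k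

@[simp] theorem mulAntipode_apply (v x : A) : h.mulAntipode v x = h.toLin (v * antipode k x) := rfl

/-- `v₍₁₎ h(v₍₂₎ S(w)) = h(v S(w₍₁₎)) w₍₂₎` -/
theorem rightHit_mul_antipode (v w : A) :
    rightHit (h.toLin ∘ₗ LinearMap.mulRight k (antipode k w)) v = leftHit (h.mulAntipode v) w := by
  let F : A →ₗ[k] A := 
    { toFun := fun w => rightHit (h.toLin ∘ₗ LinearMap.mulRight k (antipode k w)) v
      map_add' := fun x y => by
        rw [← rightHit_add]
        congr 2
        ext
        simp [mul_add]
      map_smul' := fun c x => by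
        rw [RingHom.id_apply, ← rightHit_smul]
        congr 2
        ext
        simp }
  -- Right invariance at `v S(w)` reads `v₁ S(w₂) h(v₂ S(w₁)) = h(v S(w)) 1`, whose left side is `F
  -- * S`. Convolving with the identity on the right isolates `F`.
  have hF : toConv F * toConv (antipode k) =
      toConv (Algebra.linearMap k A ∘ₗ h.mulAntipode v) := by
    ext w
    change LinearMap.mul' k A (TensorProduct.map F (antipode k) (comul w)) =
      algebraMap k A (h.toLin (v * antipode k w))
    rw [← h.rightHit_eq, rightHit, LinearMap.comp_apply, LinearMap.comp_apply, Bialgebra.comul_mul,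
      comul_antipode]
    induction comul (R := k) w with
    | zero => simp
    | add x y hx hy => simp only [map_add, mul_add, hx, hy]
    | tmul x y =>
      simp only [TensorProduct.map_tmul, LinearMap.mul'_apply, F, LinearMap.coe_mk, AddHom.coe_mk,
        rightHit, LinearMap.comp_apply, TensorProduct.comm_tmul]
      induction comul (R := k) v with
      | zero => simp
      | add p q hp hq => simp only [map_add, add_mul, hp, hq]
      | tmul p q => simp
  have : toConv F = toConv (leftHit (h.mulAntipode v)) := by
    rw [leftHit_eq_convMul, ← hF, mul_assoc, LinearMap.antipode_mul_id, mul_one]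
  exact LinearMap.congr_fun (WithConv.toConv_injective this) w

/-- `w₍₁₎ h(S(w₍₂₎) v) = h(S(w) v₍₁₎) v₍₂₎` -/
theorem leftHit_antipode_mul (v w : A) :
    leftHit (h.toLin ∘ₗ LinearMap.mulLeft k (antipode k w)) v = rightHit (h.antipodeMul v) w := by
  let F : A →ₗ[k] A := 
    { toFun := fun w => leftHit (h.toLin ∘ₗ LinearMap.mulLeft k (antipode k w)) v
      map_add' := fun x y => by
        rw [← leftHit_add]
        congr 2
        ext
        simp [add_mul]
      map_smul' := fun c x => by
        rw [RingHom.id_apply, ← leftHit_smul]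
        congr 2
        ext
        simp }
  -- Mirror argument: left invariance at `S(w) v`, then convolution with the identity on the left.
  have hF : toConv (antipode k) * toConv F =
      toConv (Algebra.linearMap k A ∘ₗ h.antipodeMul v) := by
    ext w
    change LinearMap.mul' k A (TensorProduct.map (antipode k) F (comul w)) =
      algebraMap k A (h.toLin (antipode k w * v))
    rw [← h.leftHit_eq, leftHit, LinearMap.comp_apply, LinearMap.comp_apply, Bialgebra.comul_mul,
      comul_antipode]
    induction comul (R := k) w with
    | zero => simp
    | add x y hx hy => simp only [map_add, add_mul, hx, hy]
    | tmul x y =>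
      simp only [TensorProduct.map_tmul, LinearMap.mul'_apply, F, LinearMap.coe_mk, AddHom.coe_mk,
        leftHit, LinearMap.comp_apply, TensorProduct.comm_tmul]
      induction comul (R := k) v with
      | zero => simp
      | add p q hp hq => simp only [map_add, mul_add, hp, hq]
      | tmul p q => simp
  have : toConv F = toConv (rightHit (h.antipodeMul v)) := by
    rw [rightHit_eq_convMul, ← hF, ← mul_assoc, LinearMap.id_mul_antipode, one_mul]
  exact LinearMap.congr_fun (WithConv.toConv_injective this) w

end HaarFunctional

end Haar
end GS

/-! ### Schur orthogonality and the trace property -/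

namespace GS

open Coalgebra HopfAlgebra WithConv

section Trace

variable {k A : Type u} [Field k] [Ring A] [HopfAlgebra k A]

/-- `φ(w₍₁₎) w₍₂₎ S(w₍₃₎) = φ(w) 1` -/
theorem mul_leftHit_antipode (φ : A →ₗ[k] k) (w : A) :
    LinearMap.mul' k A (TensorProduct.map (leftHit φ) (antipode k) (comul w)) =
      algebraMap k A (φ w) := by
  have : toConv (leftHit φ) * toConv (antipode k) = toConv (Algebra.linearMap k A ∘ₗ φ) := by
    rw [leftHit_eq_convMul, mul_assoc, LinearMap.id_mul_antipode, mul_one]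
  exact LinearMap.congr_fun (WithConv.toConv_injective this) w

/-- `φ(w₍₁₎) S(w₍₂₎) w₍₃₎ = φ(w) 1` -/
theorem mul_antipode_leftHit (φ : A →ₗ[k] k) (w : A) :
    LinearMap.mul' k A (TensorProduct.map (antipode k ∘ₗ leftHit φ) LinearMap.id (comul w)) =
      algebraMap k A (φ w) := by
  have h1 : toConv (antipode k ∘ₗ leftHit φ) =
      toConv (Algebra.linearMap k A ∘ₗ φ) * toConv (antipode k) := by
    ext a
    change antipode k (leftHit φ a) = LinearMap.mul' k A (TensorProduct.map _ _ (comul a))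
    rw [leftHit, LinearMap.comp_apply, LinearMap.comp_apply]
    induction comul (R := k) a with
    | zero => simp
    | add x y hx hy => simp only [map_add, hx, hy]
    | tmul x y => simp [Algebra.algebraMap_eq_smul_one]
  have : toConv (antipode k ∘ₗ leftHit φ) * toConv LinearMap.id =
      toConv (Algebra.linearMap k A ∘ₗ φ) := by
    rw [h1, mul_assoc, LinearMap.antipode_mul_id, mul_one]
  exact LinearMap.congr_fun (WithConv.toConv_injective this) w

/-- Since `Δ(w)` lies in `V ⊗ A`, it can be expanded along a basis of `V`; the coefficients are left
translates of `w` by extensions `E i` of the coordinates. -/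
theorem sum_basis_tmul_leftHit (V : Submodule (HitAlgebra k A) A) {ι : Type*} [Fintype ι]
    (e : Module.Basis ι k (V.restrictScalars k)) (E : ι → A →ₗ[k] k)
    (hE : ∀ i (v : V.restrictScalars k), E i v = e.repr v i) {w : A} (hw : w ∈ V) :
    ∑ i, (e i : A) ⊗ₜ[k] leftHit (E i) w = comul w := by
  obtain ⟨t, ht⟩ := comul_mem_range V hw
  simp only [leftHit, LinearMap.comp_apply]
  rw [← ht]
  clear ht
  induction t with
  | zero => simp
  | add x y hx hy => simp only [map_add, TensorProduct.tmul_add, Finset.sum_add_distrib, hx, hy]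
  | tmul v a =>
    simp only [LinearMap.rTensor_tmul, LinearEquiv.coe_coe, TensorProduct.lid_tmul,
      Submodule.subtype_apply, hE, TensorProduct.tmul_smul, TensorProduct.smul_tmul']
    rw [← TensorProduct.sum_tmul]
    congr 1
    have := congrArg (V.restrictScalars k).subtype (e.sum_repr v)
    rw [map_sum] at this
    exact this

/-- Separation of variables: fix `w` in `V` and `φ` with `φ w ≠ 0`, and divide by `φ w`. -/
theorem exists_eq_smul_of_symm {X : Type*} [AddCommGroup X] [Module k X] (V : Submodule k X)
    (hV : V ≠ ⊥) {lam : (X →ₗ[k] k) → X → k}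
    (h : ∀ φ ψ : X →ₗ[k] k, ∀ v ∈ V, ∀ w ∈ V, lam ψ v * φ w = lam φ w * ψ v) :
    ∃ c, ∀ ψ, ∀ v ∈ V, lam ψ v = c * ψ v := by
  obtain ⟨w, hw, hw0⟩ := V.ne_bot_iff.1 hV
  obtain ⟨φ, hφ⟩ : ∃ φ : X →ₗ[k] k, φ w ≠ 0 := by
    by_contra! H
    exact hw0 ((Module.forall_dual_apply_eq_zero_iff k w).1 H)
  refine ⟨(φ w)⁻¹ * lam φ w, fun ψ v hv => ?_⟩
  rw [mul_assoc, ← h φ ψ v hv w hw]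
  field_simp

/-- Schur's lemma for a finite-dimensional simple module over an algebraically closed field. -/
theorem exists_smul_of_mapsTo [IsAlgClosed k] (V : Submodule (HitAlgebra k A) A)
    [IsSimpleModule (HitAlgebra k A) V] (T : A →ₗ[HitAlgebra k A] A) (hT : ∀ v ∈ V, T v ∈ V) :
    ∃ c : k, ∀ v ∈ V, T v = c • v := by
  have : FiniteDimensional k V := finiteDimensional_of_isSimpleModule V
  obtain ⟨c, hc⟩ := (IsSimpleModule.algebraMap_end_bijective_of_isAlgClosed k
    (A := HitAlgebra k A) (V := V)).2 (T.restrict hT)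
  exact ⟨c, fun v hv => (congrArg Subtype.val (LinearMap.congr_fun hc ⟨v, hv⟩)).symm⟩

namespace HaarFunctional

variable (h : HaarFunctional k A)

/-- The same element is a right translate of `v`. Thus `v ∈ V` yields a module map from all of `A`
into `V`, to which Schur's lemma applies. -/
theorem leftHit_mulAntipode_mem {V : Submodule (HitAlgebra k A) A} {v : A} (hv : v ∈ V) (w : A) :
    leftHit (h.mulAntipode v) w ∈ V := by
  rw [← h.rightHit_mul_antipode]
  exact rightHit_mem_of_mem _ hv

theorem leftHit_antipode_mul_mem {V : Submodule (HitAlgebra k A) A} {w : A} (hw : w ∈ V) (v : A) :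
    leftHit (h.toLin ∘ₗ LinearMap.mulLeft k (antipode k w)) v ∈ V := by
  rw [h.leftHit_antipode_mul]
  exact rightHit_mem_of_mem _ hw

theorem apply_leftHit_mul_antipode (φ : A →ₗ[k] k) (v x : A) :
    h.toLin (leftHit φ v * antipode k x) = φ (leftHit (h.mulAntipode v) x) := by
  rw [← h.rightHit_mul_antipode, ← GS.apply_leftHit]
  rfl

theorem apply_antipode_leftHit_mul (ψ : A →ₗ[k] k) (w x : A) :
    h.toLin (antipode k (leftHit ψ w) * x) =
      ψ (leftHit (h.toLin ∘ₗ LinearMap.mulLeft k (antipode k w)) x) := by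
  rw [h.leftHit_antipode_mul, ← GS.apply_leftHit]
  rfl


/-- Combine `h ∘ S = h` with `S(a S(b)) = b S(a)`, which uses `S² = id`. -/
theorem mul_antipode_symm (hS : antipode k (A := A) ∘ₗ antipode k = LinearMap.id) (a b : A) :
    h.toLin (a * antipode k b) = h.toLin (b * antipode k a) := by
  rw [← h.apply_antipode hS, antipode_mul_antidistrib, ← LinearMap.comp_apply (antipode k), hS]
  rfl

theorem antipode_mul_symm (hS : antipode k (A := A) ∘ₗ antipode k = LinearMap.id) (a b : A) :
    h.toLin (antipode k b * a) = h.toLin (antipode k a * b) := by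
  rw [← h.apply_antipode hS, antipode_mul_antidistrib, ← LinearMap.comp_apply (antipode k) _ b, hS]
  rfl

/-- Orthogonality relation for the matrix coefficients of a simple comodule. -/
theorem exists_mul_antipode_eq [IsAlgClosed k]
    (hS : antipode k (A := A) ∘ₗ antipode k = LinearMap.id) (V : Submodule (HitAlgebra k A) A)
    [IsSimpleModule (HitAlgebra k A) V] :
    ∃ c : k, ∀ φ ψ : A →ₗ[k] k, ∀ v ∈ V, ∀ w ∈ V,
      h.toLin (leftHit φ v * antipode k (leftHit ψ w)) = c * ψ v * φ w := by
  have hV : V.restrictScalars k ≠ ⊥ := fun H =>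
    (isSimpleModule_iff_isAtom.1 ‹IsSimpleModule (HitAlgebra k A) V›).1
      ((Submodule.restrictScalars_eq_bot_iff ..).1 H)
  -- For `v ∈ V` the composite is an endomorphism of `V`, hence a scalar `lam ψ v`. Placing the
  -- condition inside the existential lets `choose` define `lam` everywhere, with irrelevant values
  -- outside `V`.
  have key (ψ : A →ₗ[k] k) (v : A) : ∃ c : k, v ∈ V → ∀ w ∈ V,
      leftHit (h.mulAntipode v) (leftHit ψ w) = c • w := by
    by_cases hv : v ∈ V
    · obtain ⟨c, hc⟩ := exists_smul_of_mapsTo V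
        (leftHitLinear (h.mulAntipode v) ∘ₗ leftHitLinear ψ)
        fun w _ => h.leftHit_mulAntipode_mem hv _
      exact ⟨c, fun _ => hc⟩
    · exact ⟨0, fun H => absurd H hv⟩
  choose lam hlam using key
  have hl (φ ψ : A →ₗ[k] k) (v) (hv : v ∈ V) (w) (hw : w ∈ V) :
      h.toLin (leftHit φ v * antipode k (leftHit ψ w)) = lam ψ v * φ w := by
    rw [h.apply_leftHit_mul_antipode, hlam ψ v hv w hw, map_smul, smul_eq_mul]
  -- The pairing is unchanged when `(φ, v)` and `(ψ, w)` are exchanged, which forces `lam ψ v` to be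
  -- a fixed multiple of `ψ v`.
  obtain ⟨c, hc⟩ := exists_eq_smul_of_symm (V.restrictScalars k) hV (lam := lam)
    fun φ ψ v hv w hw => by rw [← hl φ ψ v hv w hw, h.mul_antipode_symm hS, hl ψ φ w hw v hv]
  exact ⟨c, fun φ ψ v hv w hw => by rw [hl φ ψ v hv w hw, hc ψ v hv]⟩

/-- Orthogonality relation for the matrix coefficients of a simple comodule. -/
theorem exists_antipode_mul_eq [IsAlgClosed k]
    (hS : antipode k (A := A) ∘ₗ antipode k = LinearMap.id) (V : Submodule (HitAlgebra k A) A)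
    [IsSimpleModule (HitAlgebra k A) V] :
    ∃ c : k, ∀ φ ψ : A →ₗ[k] k, ∀ v ∈ V, ∀ w ∈ V,
      h.toLin (antipode k (leftHit ψ w) * leftHit φ v) = c * ψ v * φ w := by
  have hV : V.restrictScalars k ≠ ⊥ := fun H =>
    (isSimpleModule_iff_isAtom.1 ‹IsSimpleModule (HitAlgebra k A) V›).1
      ((Submodule.restrictScalars_eq_bot_iff ..).1 H)
  have key (φ : A →ₗ[k] k) (w : A) : ∃ c : k, w ∈ V → ∀ v ∈ V,
      leftHit (h.toLin ∘ₗ LinearMap.mulLeft k (antipode k w)) (leftHit φ v) = c • v := by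
    by_cases hw : w ∈ V
    · obtain ⟨c, hc⟩ := exists_smul_of_mapsTo V
        (leftHitLinear (h.toLin ∘ₗ LinearMap.mulLeft k (antipode k w)) ∘ₗ leftHitLinear φ)
        fun v _ => h.leftHit_antipode_mul_mem hw _
      exact ⟨c, fun _ => hc⟩
    · exact ⟨0, fun H => absurd H hw⟩
  choose lam hlam using key
  have hl (φ ψ : A →ₗ[k] k) (v) (hv : v ∈ V) (w) (hw : w ∈ V) :
      h.toLin (antipode k (leftHit ψ w) * leftHit φ v) = lam φ w * ψ v := by
    rw [h.apply_antipode_leftHit_mul, hlam φ w hw v hv, map_smul, smul_eq_mul]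
  obtain ⟨c, hc⟩ := exists_eq_smul_of_symm (V.restrictScalars k) hV (lam := lam)
    fun φ ψ v hv w hw => by rw [← hl ψ φ w hw v hv, h.antipode_mul_symm hS, hl φ ψ v hv w hw]
  exact ⟨c, fun φ ψ v hv w hw => by rw [hl φ ψ v hv w hw, hc φ w hw]; ring⟩

/-- The two constants in the orthogonality relations agree. -/
theorem mul_antipode_comm_of_mem [IsAlgClosed k]
    (hS : antipode k (A := A) ∘ₗ antipode k = LinearMap.id) (V : Submodule (HitAlgebra k A) A)
    [IsSimpleModule (HitAlgebra k A) V] (φ ψ : A →ₗ[k] k) {v w : A} (hv : v ∈ V) (hw : w ∈ V) :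
    h.toLin (leftHit φ v * antipode k (leftHit ψ w)) =
      h.toLin (antipode k (leftHit ψ w) * leftHit φ v) := by
  obtain ⟨c, hc⟩ := h.exists_mul_antipode_eq hS V
  obtain ⟨d, hd⟩ := h.exists_antipode_mul_eq hS V
  suffices hcd : c = d by rw [hc φ ψ v hv w hw, hd φ ψ v hv w hw, hcd]
  have : FiniteDimensional k (V.restrictScalars k) := finiteDimensional_of_isSimpleModule V
  let e := Module.finBasis k (V.restrictScalars k)
  -- The dual basis of `V`, extended to functionals on `A`.
  choose E hE using fun i => LinearMap.exists_extend (p := V.restrictScalars k) (e.coord i)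
  have hE' (i) (v : V.restrictScalars k) : E i v = e.repr v i := LinearMap.congr_fun (hE i) v
  obtain ⟨x, hx, hx0⟩ := V.ne_bot_iff.1
    (isSimpleModule_iff_isAtom.1 ‹IsSimpleModule (HitAlgebra k A) V›).1
  obtain ⟨θ, hθ⟩ : ∃ θ : A →ₗ[k] k, θ x ≠ 0 := by
    by_contra! H
    exact hx0 ((Module.forall_dual_apply_eq_zero_iff k x).1 H)
  have hone (i) : E i (e i) = 1 := by simp [hE']
  -- Apply `h` to `θ(x₁) x₂ S(x₃) = θ(x) 1` and to `θ(x₁) S(x₂) x₃ = θ(x) 1`, expanding `Δ(x)` in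
  -- the basis. The orthogonality relations turn the sums into `n c θ(x)` and `n d θ(x)` with `n =
  -- dim V`.
  have h1 := congrArg h.toLin (mul_leftHit_antipode θ x)
  have h2 := congrArg h.toLin (mul_antipode_leftHit θ x)
  rw [← sum_basis_tmul_leftHit V e E hE' hx] at h1 h2
  simp only [map_sum, TensorProduct.map_tmul, LinearMap.mul'_apply, LinearMap.comp_apply,
    LinearMap.id_apply, hc θ _ _ (e _).2 x hx, hd _ θ x hx _ (e _).2, hone,
    Algebra.algebraMap_eq_smul_one, map_smul, h.map_one, Finset.sum_const, smul_eq_mul,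
    nsmul_eq_mul, mul_one, Finset.card_univ, Fintype.card_fin] at h1 h2
  set n : k := (Module.finrank k (V.restrictScalars k) : k)
  have h3 : n * c = 1 := mul_right_cancel₀ hθ (by linear_combination h1)
  have h4 : n * d = 1 := mul_right_cancel₀ hθ (by linear_combination h2)
  exact mul_left_cancel₀ (left_ne_zero_of_mul_eq_one h3) (h3.trans h4.symm)

/-- An isomorphism `V ≃ W` extends to an endomorphism of `A`, that is, to a left translation, so `w`
is a left translate of an element of `V` and the case of a single simple module applies. Without an
isomorphism, Schur's lemma kills the module maps between `V` and `W` that compute the two sides. -/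
theorem mul_antipode_comm_of_isSimpleModule [IsAlgClosed k] (hA : IsCosemisimple k A)
    (hS : antipode k (A := A) ∘ₗ antipode k = LinearMap.id) (V W : Submodule (HitAlgebra k A) A)
    [IsSimpleModule (HitAlgebra k A) V] [IsSimpleModule (HitAlgebra k A) W]
    {v w : A} (hv : v ∈ V) (hw : w ∈ W) :
    h.toLin (v * antipode k w) = h.toLin (antipode k w * v) := by
  have := hA.isSemisimpleModule
  by_cases hVW : Nonempty (V ≃ₗ[HitAlgebra k A] W)
  · obtain ⟨θ⟩ := hVW
    obtain ⟨T, hT⟩ := IsSemisimpleModule.extension_property V.subtype V.injective_subtype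
      (W.subtype ∘ₗ θ.toLinearMap)
    obtain ⟨u, hu⟩ := θ.surjective ⟨w, hw⟩
    have hw' : w = leftHit (counit ∘ₗ T.restrictScalars k) u := by
      rw [← hitAlgebra_linear_eq]
      exact ((LinearMap.congr_fun hT u).trans (congrArg Subtype.val hu)).symm
    have := h.mul_antipode_comm_of_mem hS V counit (counit ∘ₗ T.restrictScalars k) hv u.2
    rwa [leftHit_counit, ← hw'] at this
  · have hl : h.toLin (v * antipode k w) = 0 := by
      let T : W →ₗ[HitAlgebra k A] V :=
        (leftHitLinear (h.mulAntipode v) ∘ₗ W.subtype).codRestrict V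
          fun w => h.leftHit_mulAntipode_mem hv _
      have hT : T = 0 := T.bijective_or_eq_zero.resolve_left fun H =>
        hVW ⟨(LinearEquiv.ofBijective T H).symm⟩
      have := congrArg Subtype.val (LinearMap.congr_fun hT ⟨w, hw⟩)
      have : leftHit (h.mulAntipode v) w = 0 := this
      rw [← mulAntipode_apply, ← counit_leftHit, this, map_zero]
    have hr : h.toLin (antipode k w * v) = 0 := by
      let T : V →ₗ[HitAlgebra k A] W :=
        (leftHitLinear (h.toLin ∘ₗ LinearMap.mulLeft k (antipode k w)) ∘ₗ V.subtype).codRestrict W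
          fun v => h.leftHit_antipode_mul_mem hw _
      have hT : T = 0 := T.bijective_or_eq_zero.resolve_left fun H =>
        hVW ⟨LinearEquiv.ofBijective T H⟩
      have := congrArg Subtype.val (LinearMap.congr_fun hT ⟨v, hv⟩)
      have : leftHit (h.toLin ∘ₗ LinearMap.mulLeft k (antipode k w)) v = 0 := this
      change (h.toLin ∘ₗ LinearMap.mulLeft k (antipode k w)) v = 0
      rw [← counit_leftHit, this, map_zero]
    rw [hl, hr]

/-- The Haar functional of a cosemisimple Hopf algebra of Kac type is a trace. -/
theorem apply_mul_comm [IsAlgClosed k] (hA : IsCosemisimple k A)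
    (hS : antipode k (A := A) ∘ₗ antipode k = LinearMap.id) (a b : A) :
    h.toLin (a * b) = h.toLin (b * a) := by
  have := hA.isSemisimpleModule
  -- Since `S` is onto, `b` may be replaced by `S(b)`. By bilinearity both arguments can then be
  -- taken in simple submodules, whose sum is `A`.
  obtain ⟨b, rfl⟩ : ∃ c, antipode k c = b := ⟨antipode k b, LinearMap.congr_fun hS b⟩
  have hmem (x : A) : x ∈ ⨆ V : {V : Submodule (HitAlgebra k A) A //
      IsSimpleModule (HitAlgebra k A) V}, V.1 := by
    have := IsSemisimpleModule.sSup_simples_eq_top (HitAlgebra k A) A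
    rw [sSup_eq_iSup'] at this
    exact this ▸ Submodule.mem_top
  refine Submodule.iSup_induction _
    (motive := fun a => h.toLin (a * antipode k b) = h.toLin (antipode k b * a)) (hmem a)
    (fun V v hv => ?_) (by simp) (fun x y hx hy => by simp only [add_mul, mul_add, map_add, hx, hy])
  refine Submodule.iSup_induction _
    (motive := fun b => h.toLin (v * antipode k b) = h.toLin (antipode k b * v)) (hmem b)
    (fun W w hw => ?_) (by simp) (fun x y hx hy => by simp only [add_mul, mul_add, map_add, hx, hy])
  have := V.2
  have := W.2
  exact h.mul_antipode_comm_of_isSimpleModule hA hS V.1 W.1 hv hw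

end HaarFunctional

end Trace
end GS

/-! ### Averaging cochains over the Haar functional -/

namespace GS

open Coalgebra HopfAlgebra WithConv

section Average

variable {k A : Type u} [Field k] [Ring A] [HopfAlgebra k A]

/-- The map `n ⊗ b ↦ φ(b) n`. -/
noncomputable def slice (N : Type u) [AddCommGroup N] [Module k N] (φ : A →ₗ[k] k) :
    N ⊗[k] A →ₗ[k] N :=
  (TensorProduct.rid k N).toLinearMap ∘ₗ φ.lTensor N

@[simp] theorem slice_tmul {N : Type u} [AddCommGroup N] [Module k N] (φ : A →ₗ[k] k) (n : N)
    (b : A) : slice N φ (n ⊗ₜ b) = φ b • n := by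
  simp [slice]

theorem slice_rTensor {M N : Type u} [AddCommGroup M] [Module k M] [AddCommGroup N] [Module k N]
    (φ : A →ₗ[k] k) (f : M →ₗ[k] N) (t : M ⊗[k] A) :
    slice N φ (f.rTensor A t) = f (slice M φ t) := by
  induction t with
  | zero => simp
  | add x y hx hy => simp only [map_add, hx, hy]
  | tmul m a => simp

theorem slice_assoc_symm_comul {N : Type u} [AddCommGroup N] [Module k N] (φ : A →ₗ[k] k)
    (t : N ⊗[k] A) :
    slice (N ⊗[k] A) φ ((TensorProduct.assoc k N A A).symm (comul.lTensor N t)) =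
      (rightHit φ).lTensor N t := by
  induction t with
  | zero => simp
  | add x y hx hy => simp only [map_add, hx, hy]
  | tmul n a =>
    simp only [LinearMap.lTensor_tmul, rightHit, LinearMap.comp_apply]
    induction comul (R := k) a with
    | zero => simp
    | add x y hx hy => simp only [map_add, TensorProduct.tmul_add, hx, hy]
    | tmul x y => simp

theorem rTensor_coact_coact {N : Type u} [AddCommGroup N] [Module k N] (ρ : RightCoaction k A N)
    (n : N) : ρ.coact.rTensor A (ρ.coact n) =
      (TensorProduct.assoc k N A A).symm (comul.lTensor N (ρ.coact n)) := by
  rw [LinearEquiv.eq_symm_apply]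
  exact LinearMap.congr_fun ρ.coassoc n

namespace HaarFunctional

variable (h : HaarFunctional k A)

/-- The map `(n ⊗ b) ⊗ c ↦ h(b S(c)) n`. -/
noncomputable def contract (N : Type u) [AddCommGroup N] [Module k N] :
    (N ⊗[k] A) ⊗[k] A →ₗ[k] N :=
  (TensorProduct.rid k N).toLinearMap ∘ₗ
    (h.toLin ∘ₗ LinearMap.mul' k A ∘ₗ (antipode k).lTensor A).lTensor N ∘ₗ
      (TensorProduct.assoc k N A A).toLinearMap

@[simp] theorem contract_tmul_tmul {N : Type u} [AddCommGroup N] [Module k N] (n : N) (b c : A) :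
    h.contract N ((n ⊗ₜ b) ⊗ₜ c) = h.toLin (b * antipode k c) • n := by
  simp [contract]

theorem contract_tmul {N : Type u} [AddCommGroup N] [Module k N] (z : N ⊗[k] A) (c : A) :
    h.contract N (z ⊗ₜ c) = slice N (h.toLin ∘ₗ LinearMap.mulRight k (antipode k c)) z := by
  induction z with
  | zero => simp
  | add x y hx hy => simp only [TensorProduct.add_tmul, map_add, hx, hy]
  | tmul n b => simp

variable {M N P : Type u} [AddCommGroup M] [Module k M] [AddCommGroup N] [Module k N]
  [AddCommGroup P] [Module k P]

/-- The average `m ↦ f(m₍₀₎)₍₀₎ h(f(m₍₀₎)₍₁₎ S(m₍₁₎))` of a linear map between comodules. -/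
noncomputable def average (r : M →ₗ[k] M ⊗[k] A) (s : N →ₗ[k] N ⊗[k] A) (f : M →ₗ[k] N) :
    M →ₗ[k] N :=
  h.contract N ∘ₗ (s ∘ₗ f).rTensor A ∘ₗ r

theorem average_add (r : M →ₗ[k] M ⊗[k] A) (s : N →ₗ[k] N ⊗[k] A) (f g : M →ₗ[k] N) :
    h.average r s (f + g) = h.average r s f + h.average r s g := by
  simp only [average, LinearMap.comp_add, LinearMap.add_comp, LinearMap.rTensor_add]

theorem average_smul (r : M →ₗ[k] M ⊗[k] A) (s : N →ₗ[k] N ⊗[k] A) (c : k) (f : M →ₗ[k] N) :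
    h.average r s (c • f) = c • h.average r s f := by
  simp only [average, LinearMap.comp_smul, LinearMap.smul_comp, LinearMap.rTensor_smul]

/-- Used with `g` the bar differential, this handles every face of the Hochschild differential
except the last. -/
theorem average_comp {r : M →ₗ[k] M ⊗[k] A} {s : N →ₗ[k] N ⊗[k] A} (t : P →ₗ[k] P ⊗[k] A)
    (f : N →ₗ[k] P) {g : M →ₗ[k] N} (hg : s ∘ₗ g = g.rTensor A ∘ₗ r) :
    h.average r t (f ∘ₗ g) = h.average s t f ∘ₗ g := by
  simp only [average, LinearMap.rTensor_comp, LinearMap.comp_assoc, hg]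

/-- For colinear `f` the average is `f(m₀) h(m₁ S(m₂))`, which is `f(m)` by the antipode axiom and
`h(1) = 1`. -/
theorem average_of_colinear (ρ : RightCoaction k A M) {s : N →ₗ[k] N ⊗[k] A} {f : M →ₗ[k] N}
    (hf : s ∘ₗ f = f.rTensor A ∘ₗ ρ.coact) : h.average ρ.coact s f = f := by
  have key (t : M ⊗[k] A) : h.contract N ((f.rTensor A).rTensor A
      ((TensorProduct.assoc k M A A).symm (comul.lTensor M t))) = f (slice M counit t) := by
    induction t with
    | zero => simp
    | add x y hx hy => simp only [map_add, hx, hy]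
    | tmul m a =>
      have h1 (q : A ⊗[k] A) : h.contract N ((f.rTensor A).rTensor A
          ((TensorProduct.assoc k M A A).symm (m ⊗ₜ q))) =
          h.toLin (LinearMap.mul' k A ((antipode k).lTensor A q)) • f m := by
        induction q with
        | zero => simp
        | add x y hx hy => simp only [map_add, TensorProduct.tmul_add, add_smul, hx, hy]
        | tmul x y => simp
      rw [LinearMap.lTensor_tmul, h1, mul_antipode_lTensor_comul_apply]
      simp [Algebra.algebraMap_eq_smul_one, h.map_one]
  refine LinearMap.ext fun m => ?_
  have hm : slice M counit (ρ.coact m) = m := by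
    have := congrArg (TensorProduct.rid k M) (LinearMap.congr_fun ρ.counit m)
    simpa [slice] using this
  rw [average, hf, LinearMap.rTensor_comp]
  simp only [LinearMap.comp_apply]
  rw [rTensor_coact_coact, key, hm]

/-- The coaction of the average contains `v₁ h(v₂ S(w))` with `v = f(m₀)₁` and `w = m₁`. By
`rightHit_mul_antipode` this is `h(v S(w₁)) w₂`, so the remaining factor in `A` comes from the
coaction of `m`. -/
theorem average_colinear (ρ : RightCoaction k A M) (σ : RightCoaction k A N) (f : M →ₗ[k] N) :
    σ.coact ∘ₗ h.average ρ.coact σ.coact f =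
      (h.average ρ.coact σ.coact f).rTensor A ∘ₗ ρ.coact := by
  have key1 (z : N ⊗[k] A) (c : A) : (h.contract N).rTensor A
      ((TensorProduct.assoc k (N ⊗[k] A) A A).symm (z ⊗ₜ comul c)) =
        (rightHit (h.toLin ∘ₗ LinearMap.mulRight k (antipode k c))).lTensor N z := by
    induction z with
    | zero => simp
    | add x y hx hy => simp only [map_add, TensorProduct.add_tmul, hx, hy]
    | tmul n b =>
      rw [LinearMap.lTensor_tmul, h.rightHit_mul_antipode]
      simp only [leftHit, LinearMap.comp_apply]
      induction comul (R := k) c with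
      | zero => simp
      | add x y hx hy => simp only [map_add, TensorProduct.tmul_add, hx, hy]
      | tmul x y => simp [TensorProduct.smul_tmul']
  have key2 (t : M ⊗[k] A) : σ.coact (h.contract N ((σ.coact ∘ₗ f).rTensor A t)) =
      (h.contract N).rTensor A (((σ.coact ∘ₗ f).rTensor A).rTensor A
        ((TensorProduct.assoc k M A A).symm (comul.lTensor M t))) := by
    induction t with
    | zero => simp
    | add x y hx hy => simp only [map_add, hx, hy]
    | tmul m c =>
      have h1 (q : A ⊗[k] A) : ((σ.coact ∘ₗ f).rTensor A).rTensor A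
          ((TensorProduct.assoc k M A A).symm (m ⊗ₜ q)) =
          (TensorProduct.assoc k (N ⊗[k] A) A A).symm (σ.coact (f m) ⊗ₜ q) := by
        induction q with
        | zero => simp
        | add x y hx hy => simp only [map_add, TensorProduct.tmul_add, hx, hy]
        | tmul x y => simp
      rw [LinearMap.lTensor_tmul, h1, key1, LinearMap.rTensor_tmul, contract_tmul,
        ← slice_rTensor, LinearMap.comp_apply, rTensor_coact_coact, slice_assoc_symm_comul]
  refine LinearMap.ext fun m => ?_
  refine (key2 (ρ.coact m)).trans ?_
  rw [← rTensor_coact_coact, ← LinearMap.rTensor_comp_apply, ← LinearMap.rTensor_comp_apply]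
  rfl

/-- The map `p ⊗ (y ⊗ q) ↦ h(p b q S(c)) n ← y`. -/
noncomputable def twistedAct (β : N →ₗ[k] A →ₗ[k] N) (n : N) (b c : A) :
    A ⊗[k] (A ⊗[k] A) →ₗ[k] N :=
  (TensorProduct.rid k N).toLinearMap ∘ₗ TensorProduct.map (β n)
    (h.toLin ∘ₗ LinearMap.mulRight k (antipode k c) ∘ₗ LinearMap.mul' k A ∘ₗ
      (LinearMap.mulRight k b).rTensor A) ∘ₗ (TensorProduct.leftComm k A A A).toLinearMap

@[simp] theorem twistedAct_tmul (β : N →ₗ[k] A →ₗ[k] N) (n : N) (b c p y q : A) :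
    h.twistedAct β n b c (p ⊗ₜ (y ⊗ₜ q)) = h.toLin (p * b * q * antipode k c) • β n y := by
  simp [twistedAct]

end HaarFunctional

variable (k A) in
/-- The map `x ⊗ (y₁ ⊗ (y₂ ⊗ (y₃ ⊗ z))) ↦ x S(y₁) ⊗ (y₂ ⊗ y₃ S(z))`. -/
noncomputable def collapseEnds :
    A ⊗[k] (A ⊗[k] (A ⊗[k] (A ⊗[k] A))) →ₗ[k] A ⊗[k] (A ⊗[k] A) :=
  TensorProduct.map (LinearMap.mul' k A ∘ₗ (antipode k).lTensor A)
    ((LinearMap.mul' k A ∘ₗ (antipode k).lTensor A).lTensor A) ∘ₗ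
      (TensorProduct.assoc k A A _).symm.toLinearMap

@[simp] theorem collapseEnds_tmul (x y₁ y₂ y₃ z : A) :
    collapseEnds k A (x ⊗ₜ (y₁ ⊗ₜ (y₂ ⊗ₜ (y₃ ⊗ₜ z)))) =
      (x * antipode k y₁) ⊗ₜ (y₂ ⊗ₜ (y₃ * antipode k z)) := by
  simp [collapseEnds]

/-- By coassociativity the five factors may be obtained by splitting the outer ones instead of the
middle one; the antipode axiom then collapses `a₁ S(a₂)` and `a₄ S(a₅)`. -/
theorem collapseEnds_expandMid (a : A) :
    collapseEnds k A (expandMid k A (comul₃ k A a)) = 1 ⊗ₜ (a ⊗ₜ 1) := by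
  have h1 : collapseEnds k A ∘ₗ expandEnds k A = TensorProduct.map
      (Algebra.linearMap k A ∘ₗ counit) ((Algebra.linearMap k A ∘ₗ counit).lTensor A) := by
    rw [← mul_antipode_lTensor_comul]
    refine TensorProduct.ext_threefold' fun x y z => ?_
    simp [collapseEnds, expandEnds]
  have h2 := LinearMap.congr_fun (expand_comul₃ (k := k) (A := A)) a
  rw [LinearMap.comp_apply] at h2
  rw [h2, LinearMap.comp_apply, ← LinearMap.comp_apply (collapseEnds k A), h1]
  have h3 (t : A ⊗[k] A) : TensorProduct.map (Algebra.linearMap k A ∘ₗ counit)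
      ((Algebra.linearMap k A ∘ₗ counit).lTensor A) (comul.lTensor A t) =
      1 ⊗ₜ (TensorProduct.lid k A (counit.rTensor A t) ⊗ₜ 1) := by
    induction t with
    | zero => simp
    | add x y hx hy => simp only [map_add, TensorProduct.add_tmul, TensorProduct.tmul_add, hx, hy]
    | tmul x y =>
      have h4 : (Algebra.linearMap k A ∘ₗ counit).lTensor A (comul y) = y ⊗ₜ (1 : A) := by
        rw [LinearMap.lTensor_comp, LinearMap.comp_apply, lTensor_counit_comul]
        simp
      simp [h4, Algebra.algebraMap_eq_smul_one, ← TensorProduct.smul_tmul']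
  rw [comul₃, LinearMap.comp_apply, h3, rTensor_counit_comul]
  simp

namespace HaarFunctional

variable (h : HaarFunctional k A)

/-- For `u = n ⊗ b` the left side is `h(S(a₂) b a₄ S(S(a₁) c a₅)) n ← a₃`. Since `S² = id`, the
argument of `h` ends in `a₁`. The trace property moves it to the front, giving `h(a₁ S(a₂) b a₄
S(a₅) S(c)) n ← a₃`, and both ends collapse. -/
theorem contract_ydTwist (htr : ∀ a b, h.toLin (a * b) = h.toLin (b * a))
    (hS : antipode k (A := A) ∘ₗ antipode k = LinearMap.id) {N : Type u} [AddCommGroup N]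
    [Module k N] (β : N →ₗ[k] A →ₗ[k] N) (u : N ⊗[k] A) (c a : A) :
    h.contract N (TensorProduct.map (ydTwist β u ∘ₗ comul₃ k A) (sandwich k A c)
      (TensorProduct.leftComm k A A A (comul₃ k A a))) = β (h.contract N (u ⊗ₜ c)) a := by
  have hS' (x : A) : antipode k (antipode k x) = x := LinearMap.congr_fun hS x
  induction u with
  | zero => simp
  | add x y hx hy =>
    simp only [map_add, TensorProduct.add_tmul, LinearMap.add_comp, TensorProduct.map_add_left,
      LinearMap.add_apply, hx, hy]
  | tmul n b =>
    have key (p : A ⊗[k] (A ⊗[k] A)) :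
        h.contract N (TensorProduct.map (ydTwist β (n ⊗ₜ b) ∘ₗ comul₃ k A) (sandwich k A c)
          (TensorProduct.leftComm k A A A p)) =
          h.twistedAct β n b c (collapseEnds k A (expandMid k A p)) := by
      induction p with
      | zero => simp
      | add x y hx hy => simp only [map_add, hx, hy]
      | tmul x p =>
        induction p with
        | zero => simp
        | add x y hx hy => simp only [map_add, TensorProduct.tmul_add, hx, hy]
        | tmul y z =>
          have h1 (q : A ⊗[k] (A ⊗[k] A)) :
              h.contract N (ydTwist β (n ⊗ₜ b) q ⊗ₜ (antipode k x * c * z)) =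
              h.twistedAct β n b c (collapseEnds k A
                (x ⊗ₜ ((TensorProduct.assoc k A A A).toLinearMap.lTensor A
                  (TensorProduct.assoc k A (A ⊗[k] A) A (q ⊗ₜ z))))) := by
            induction q with
            | zero => simp
            | add x y hx hy =>
              simp only [map_add, TensorProduct.add_tmul, TensorProduct.tmul_add, hx, hy]
            | tmul y₁ q =>
              induction q with
              | zero => simp
              | add x y hx hy =>
                simp only [map_add, TensorProduct.add_tmul, TensorProduct.tmul_add, hx, hy]
              | tmul y₂ y₃ =>
                simp only [ydTwist_tmul, contract_tmul_tmul, antipode_mul_antidistrib, hS',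
                  TensorProduct.assoc_tmul, LinearMap.lTensor_tmul, LinearEquiv.coe_coe,
                  collapseEnds_tmul, twistedAct_tmul]
                congr 1
                -- The trace property brings `x = S²(x)` from the right end to the left of `S(y₁)`.
                rw [← mul_assoc, ← mul_assoc, htr]
                simp only [mul_assoc]
          rw [TensorProduct.leftComm_tmul, TensorProduct.map_tmul, sandwich_tmul,
            LinearMap.comp_apply, h1]
          rfl
    rw [key, collapseEnds_expandMid]
    simp

/-- Averaging commutes with the last Hochschild face: the compatibility condition of `V` rewrites
the coaction of `f(w) ← a₂` in the form that `contract_ydTwist` evaluates. -/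
theorem average_act (htr : ∀ a b, h.toLin (a * b) = h.toLin (b * a))
    (hS : antipode k (A := A) ∘ₗ antipode k = LinearMap.id) (V : YD k A) {W : Type u}
    [AddCommGroup W] [Module k W] (r : W →ₗ[k] W ⊗[k] A) (f : W →ₗ[k] V.carrier) :
    h.average (boxCoact r) V.coact (TensorProduct.lift (V.act ∘ₗ f)) =
      TensorProduct.lift (V.act ∘ₗ h.average r V.coact f) := by
  refine TensorProduct.ext' fun w a => ?_
  have key (t : W ⊗[k] A) : h.contract V.carrier
      ((V.coact ∘ₗ TensorProduct.lift (V.act ∘ₗ f)).rTensor A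
        (ydTwist (TensorProduct.mk k W A) t (comul₃ k A a))) =
      V.act (h.contract V.carrier ((V.coact ∘ₗ f).rTensor A t)) a := by
    induction t with
    | zero => simp
    | add x y hx hy => simp only [map_add, LinearMap.add_apply, hx, hy]
    | tmul w c =>
      rw [LinearMap.rTensor_tmul, ← h.contract_ydTwist htr hS]
      congr 1
      induction comul₃ k A a with
      | zero => simp
      | add x y hx hy => simp only [map_add, hx, hy]
      | tmul x p =>
        induction p with
        | zero => simp
        | add x y hx hy => simp only [map_add, TensorProduct.tmul_add, hx, hy]
        | tmul y z => simp [ydTwist_tmul, sandwich_tmul, V.compat]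
  simp only [average, LinearMap.comp_apply, boxCoact_tmul, TensorProduct.lift.tmul]
  exact key (r w)

theorem hochschildD_average (htr : ∀ a b, h.toLin (a * b) = h.toLin (b * a))
    (hS : antipode k (A := A) ∘ₗ antipode k = LinearMap.id) (V : YD k A) (n : ℕ)
    (f : TPow k A n →ₗ[k] V.carrier) :
    h.average (YD.boxPow k A (n + 1)).coact V.coact (hochschildD (epsBimodule V) n f) =
      hochschildD (epsBimodule V) n (h.average (YD.boxPow k A n).coact V.coact f) := by
  rw [epsBimodule_barD, epsBimodule_barD, average_add, average_smul]
  congr 1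
  · exact h.average_comp V.coact f (LinearMap.ext (YD.barD k A n).map_coact)
  · congr 1
    exact h.average_act htr hS V (YD.boxPow k A n).coact f

end HaarFunctional

/-- If a colinear cocycle `z` equals `∂g`, averaging fixes `z` and commutes with `∂`, so the average
of `g` is a colinear primitive of `z`. In degree `0` neither complex has nonzero coboundaries. -/
theorem colinearToHochschild_injective [IsAlgClosed k] (hA : IsCosemisimple k A)
    (hS : antipode k (A := A) ∘ₗ antipode k = LinearMap.id) (V : YD k A) (n : ℕ) :
    Function.Injective (colinearToHochschild V n) := by
  obtain ⟨h⟩ := hA.nonempty_haar hS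
  rw [← LinearMap.ker_eq_bot, LinearMap.ker_eq_bot']
  intro x hx
  obtain ⟨z, rfl⟩ := Submodule.Quotient.mk_surjective _ x
  have hz : z.1 ∈ coboundaries (epsBimodule V) n := 
    (Submodule.Quotient.mk_eq_zero ((coboundaries (epsBimodule V) n).submoduleOf
      (cocycles (epsBimodule V) n))).1 hx
  refine (Submodule.Quotient.mk_eq_zero _).2 ?_
  change z.1 ∈ colinearCoboundaries V n
  cases n with
  | zero => exact hz
  | succ n =>
    obtain ⟨g, hg⟩ := hz
    refine ⟨_, h.average_colinear (YD.boxPow k A n).co V.co g, ?_⟩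
    refine (h.hochschildD_average (h.apply_mul_comm hA hS) hS V n g).symm.trans ?_
    rw [hg]
    exact h.average_of_colinear (YD.boxPow k A (n + 1)).co z.2.1

end Average

end GS

theorem mainTheorem5 {k A : Type u} [Field k] [IsAlgClosed k] [CharZero k] [Ring A]
    [HopfAlgebra k A] (hA : GS.IsCosemisimple k A)
    (hS : HopfAlgebra.antipode k (A := A) ∘ₗ HopfAlgebra.antipode k = LinearMap.id)
    (V : GS.YD k A) :
    ∃ (hP : ∀ n, CategoryTheory.Projective ((GS.YD.barComplex k A).X n))
      (hQ : QuasiIso (GS.YD.barAug k A)), ∀ n : ℕ,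
      ∃ Ψ : GS.ColinearCohomology V n ≃ₗ[k] GS.GSCohomology V n,
        (∀ z : GS.colinearCocycles V n, Ψ (Submodule.Quotient.mk z) =
          (GS.YD.barResolution hP hQ).extMk (GS.cocycleHom V n z) (n + 1) rfl
            (GS.d_comp_cocycleHom V n z)) ∧
        Function.Injective (GS.colinearToHochschild V n ∘ₗ Ψ.symm.toLinearMap) :=
  ⟨GS.YD.projective_barComplex hA, GS.YD.quasiIso_barAug, fun n =>
    ⟨GS.colinearEquivGS _ _ V n, fun z => GS.colinearEquivGS_mk _ _ V n z,
      (GS.colinearToHochschild_injective hA hS V n).comp (LinearEquiv.injective _)⟩⟩
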